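/- **Planted clique conjecture.** For $\kappa\le n$ let $H_0$ be the law of the random graph on $n$ vertices in which every edge is present independently with probability $\frac12$, and let $H_1$ be the law obtained from it by choosing in addition, independently of the edges, a uniformly random set of $\kappa$ vertices and adding all edges with both endpoints in that set. For an algorithm $A$ that receives the graph and answers $0$ or $1$, let $\mathrm{err}_A(n,\kappa)=\max\{\Pr_{H_0}(A=1),\Pr_{H_1}(A=0)\}$. The planted clique conjecture asserts: for all $\kappa:\mathbb N\to\mathbb N$ with $\kappa(n)\le n$ and $\kappa(n)=o(\sqrt n)$, every (deterministic) polynomial-time algorithm $A$ and every $\delta>0$, one has $\mathrm{err}_A(n,\kappa(n))>\frac12-\delta$ for all sufficiently large $n$. The weak planted clique conjecture asserts this only for infinitely many $n$, that is, $A$ does not satisfy $\mathrm{err}_A(n,\kappa(n))\le\frac12-\delta$ for all large $n$. **Testing problem.** A matrix $M\in[0,1]^{d\times d}$ is SST if $M_{ij}=1-M_{ji}$ for all $i,j$ and there is a permutation $\pi$ of $[d]$ such that $\pi(i)<\pi(j)$ implies $M_{i\ell}\ge M_{j\ell}$ for all $\ell$. Let $P,Q$ be SST matrices. One comparison is observed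 for each pair $i<j$ from each population: $X_{ij}\sim\mathrm{Bernoulli}(P_{ij})$ and $Y_{ij}\sim\mathrm{Bernoulli}(Q_{ij})$, all independent (and $X_{ij}=Y_{ij}=0$ for $i\ge j$). The hypotheses are $H_0:P=Q$ and $H_1:\frac1d\|P-Q\|_F\ge\epsilon$. A polynomial-time testing algorithm $\phi=(\phi_d)_{d\in\mathbb N}$ is a family of tests $\phi_d:(X,Y)\mapsto\{0,1\}$ computed by one Turing machine in time polynomial in the size of the data $X,Y$, and hence polynomial in $d$. Its risk is $$\mathcal R_{\phi,d}(\epsilon)=\sup_{P=Q\ \text{SST}}\Pr(\phi_d=1)+\sup_{P,Q\ \text{SST},\ \frac1d\|P-Q\|_F\ge\epsilon}\Pr(\phi_d=0)$$ (a supremum over the empty set is $0$), and its critical radius is $\epsilon_\phi(d)=\inf\{\epsilon>0:\mathcal R_{\phi,d}(\epsilon)\le\frac13\}\in[0,\infty]$. **Theorem.** If the planted clique conjecture holds, then there is a constant $c>0$ such that every polynomial-time testing algorithm $\phi$ satisfies $$\epsilon_\phi(d)^2>\frac{c}{d\,(\log\log d)^2}$$ for all sufficiently large $d$ (how large may depend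 on $\phi$). If only the weak planted clique conjecture holds, then there is a constant $c>0$ such that every polynomial-time testing algorithm satisfies this inequality for infinitely many $d$. -/

import Mathlib

open MeasureTheory ProbabilityTheory Filter Asymptotics
open scoped ENNReal

/-! ### Polynomial-time decision procedures -/

/-- A matrix of bits, written row by row; every row is closed by the separator `none`. -/
def encodeBitMatrix {n : ℕ} (M : Fin n → Fin n → Bool) : List (Option Bool) :=
  (List.ofFn fun i => (List.ofFn fun j => some (M i j)) ++ [none]).flatten

/-- The yes/no question `f` is decided by a Turing machine in time polynomial in the length of the
encoded input. -/
def IsPolyTime {α : Type} (enc : α → List (Option Bool)) (f : α → Bool) : Prop :=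
  Nonempty (Turing.TM2ComputableInPolyTime enc Computability.encodeBool f)

/-! ### The planted clique problem -/

/-- The probability `1 / 2`. -/
noncomputable def oneHalf : unitInterval :=
  ⟨1 / 2, by norm_num, by norm_num⟩

/-- A graph is given to an algorithm by its adjacency matrix. -/
noncomputable def encodeGraph {n : ℕ} (G : SimpleGraph (Fin n)) : List (Option Bool) :=
  open scoped Classical in encodeBitMatrix fun i j => decide (G.Adj i j)

/-- A polynomial-time algorithm on graphs with a binary answer; `true` means that it claims the
presence of a planted clique. -/
structure PolyTimeGraphAlgorithm where
  run : (n : ℕ) → SimpleGraph (Fin n) → Bool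
  polyTime : IsPolyTime (fun G : Σ n, SimpleGraph (Fin n) => encodeGraph G.2)
    (fun G => run G.1 G.2)

/-- Add to `G` all edges with both endpoints in `S`. -/
def plantClique {n : ℕ} (G : SimpleGraph (Fin n)) (S : Finset (Fin n)) : SimpleGraph (Fin n) :=
  G ⊔ SimpleGraph.fromRel fun v w => v ∈ S ∧ w ∈ S

namespace PolyTimeGraphAlgorithm

/-- Probability of the answer `true` when every edge is present independently with
probability `1 / 2`. -/
noncomputable def errorNull (A : PolyTimeGraphAlgorithm) (n : ℕ) : ℝ :=
  (SimpleGraph.binomialRandom (Fin n) oneHalf).real {G | A.run n G = true}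

/-- Probability of the answer `false` when in addition a clique is planted on a uniformly random
set of `κ` vertices, independent of the edges (used for `κ ≤ n`). -/
noncomputable def errorPlanted (A : PolyTimeGraphAlgorithm) (n κ : ℕ) : ℝ :=
  (∑ S ∈ (Finset.univ : Finset (Fin n)).powersetCard κ,
    (SimpleGraph.binomialRandom (Fin n) oneHalf).real {G | A.run n (plantClique G S) = false}) /
      (n.choose κ : ℝ)

/-- The probability of a wrong answer, under the less favourable of the two hypotheses. -/
noncomputable def errorProb (A : PolyTimeGraphAlgorithm) (n κ : ℕ) : ℝ :=
  max (A.errorNull n) (A.errorPlanted n κ)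

end PolyTimeGraphAlgorithm

/-- The planted clique conjecture: if `κ = o(√n)`, then for no polynomial-time algorithm is the
error probability bounded away from `1 / 2` from below along infinitely many `n`. -/
def PlantedCliqueConjecture : Prop :=
  ∀ κ : ℕ → ℕ, (∀ n, κ n ≤ n) →
    (fun n => (κ n : ℝ)) =o[atTop] (fun n : ℕ => Real.sqrt n) →
    ∀ A : PolyTimeGraphAlgorithm, ∀ δ : ℝ, 0 < δ →
      ∀ᶠ n in atTop, 1 / 2 - δ < A.errorProb n (κ n)

/-- The weaker form of the planted clique conjecture: if `κ = o(√n)`, then for no polynomial-time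
algorithm is the error probability at most `1 / 2 - δ`, with a fixed `δ > 0`, for all large `n`. -/
def WeakPlantedCliqueConjecture : Prop :=
  ∀ κ : ℕ → ℕ, (∀ n, κ n ≤ n) →
    (fun n => (κ n : ℝ)) =o[atTop] (fun n : ℕ => Real.sqrt n) →
    ∀ A : PolyTimeGraphAlgorithm, ∀ δ : ℝ, 0 < δ →
      ∃ᶠ n in atTop, 1 / 2 - δ < A.errorProb n (κ n)

/-! ### Two-sample testing with pairwise comparisons -/

/-- Strong stochastic transitivity of a matrix of pairwise-comparison probabilities
(`unitInterval.symm p` is `1 - p`). -/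
def IsSST {d : ℕ} (M : Matrix (Fin d) (Fin d) unitInterval) : Prop :=
  (∀ i j, M i j = unitInterval.symm (M j i)) ∧
    ∃ π : Equiv.Perm (Fin d), ∀ i j, π i < π j → ∀ l, M j l ≤ M i l

/-- The law of the outcomes of one comparison for each pair `i < j`: the entries `(i, j)` are
independent, the entry `(i, j)` with `i < j` is `true` (item `i` beats item `j`) with probability
`P i j`, and the entries with `j ≤ i`, for which there is no comparison, are `false`. -/
noncomputable def comparisonLaw {d : ℕ} (P : Matrix (Fin d) (Fin d) unitInterval) :
    Measure (Fin d → Fin d → Bool) :=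
  Measure.pi fun i => Measure.pi fun j =>
    bernoulliMeasure true false (if i < j then P i j else 0)

/-- The normalised Frobenius distance `‖P - Q‖_F / d`. -/
noncomputable def frobeniusDist {d : ℕ} (P Q : Matrix (Fin d) (Fin d) unitInterval) : ℝ :=
  1 / (d : ℝ) * Real.sqrt (∑ i, ∑ j, ((P i j : ℝ) - (Q i j : ℝ)) ^ 2)

/-- The data of a test: the number of items and the outcomes in the two samples. -/
abbrev ComparisonData : Type :=
  Σ d : ℕ, (Fin d → Fin d → Bool) × (Fin d → Fin d → Bool)

/-- The data are given to an algorithm as the two matrices of outcomes, one after the other. -/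
def encodeComparisonData (D : ComparisonData) : List (Option Bool) :=
  encodeBitMatrix D.2.1 ++ encodeBitMatrix D.2.2

/-- A polynomial-time testing algorithm: for every number `d` of items a test of the data, `true`
meaning that the null hypothesis is rejected, all of them computed by one machine. -/
structure PolyTimeTest where
  test : (d : ℕ) → (Fin d → Fin d → Bool) → (Fin d → Fin d → Bool) → Bool
  polyTime : IsPolyTime encodeComparisonData (fun D => test D.1 D.2.1 D.2.2)

/-- The probability that the answer of a test is `b` when the samples are governed by
`P` and `Q`. -/
noncomputable def answerProb {d : ℕ} (φ : (Fin d → Fin d → Bool) → (Fin d → Fin d → Bool) → Bool)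
    (P Q : Matrix (Fin d) (Fin d) unitInterval) (b : Bool) : ℝ≥0∞ :=
  ((comparisonLaw P).prod (comparisonLaw Q)) {D | φ D.1 D.2 = b}

/-- The risk over the SST class of a test of `P = Q` against `‖P - Q‖_F / d ≥ ε`: the largest
Type I error plus the largest Type II error. -/
noncomputable def sstRisk {d : ℕ} (φ : (Fin d → Fin d → Bool) → (Fin d → Fin d → Bool) → Bool)
    (ε : ℝ) : ℝ≥0∞ :=
  (⨆ (P : Matrix (Fin d) (Fin d) unitInterval) (_ : IsSST P), answerProb φ P P true) +
    ⨆ (P : Matrix (Fin d) (Fin d) unitInterval) (Q : Matrix (Fin d) (Fin d) unitInterval)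
      (_ : IsSST P) (_ : IsSST Q) (_ : ε ≤ frobeniusDist P Q), answerProb φ P Q false

/-- The critical radius of a testing algorithm with `d` items: the infimum of those `ε > 0` for
which its risk is at most `1 / 3` (`∞` if there are none). -/
noncomputable def PolyTimeTest.criticalRadius (φ : PolyTimeTest) (d : ℕ) : ℝ≥0∞ :=
  ⨅ (ε : ℝ) (_ : 0 < ε) (_ : sstRisk (φ.test d) ε ≤ 1 / 3), ENNReal.ofReal ε

/-! A graph on `n` vertices becomes comparison data on `d = n / 2` items without extra randomness.
Item `i` owns the vertices `2i` and `2i+1`; for `i < j` the edge `{2i, 2j+1}` decides the first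
sample and `{2i+1, 2j}` the second. These edges are pairwise distinct, so without a clique all
comparisons are independent fair coins and `P = Q`. For a clique on `S` put `A = {i : 2i ∈ S}` and
`B = {i : 2i+1 ∈ S}`. Given `S`, the comparisons stay independent (`map_graphSample`); in the first
sample `i < j` is a sure win for `i` when `i ∈ A`, `j ∈ B`, in the second the roles of `A` and `B`
are exchanged. If `A` and `B` are disjoint, both matrices are SST (`isSST_stairMatrix`) and they
differ by `1/2` at every `i < j` with `i ∈ A`, `j ∈ B`.

For a random `S` of size `k`, disjointness fails with probability at most `k²/n`. Except with
probability `64/k`, `A` has at least `k/16` items in the first half and `B` at least `k/16` in the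
second, so that `‖P - Q‖_F ≥ k/32`. With `k ≈ √n / log log n` the exceptional probabilities vanish,
while `(‖P - Q‖_F / d)²` is at least of order `1 / (d (log log d)²)`. A test with risk at most `1/3`
at such a radius would solve planted clique with error at most `1/2 - 1/12` (`errorNull_le`,
`errorPlanted_le`, `eventually_errorProb_le`).

The conjecture concerns Turing machines, so the reduction is carried out by a stack machine placed
in front of the machine of the test (`IsPolyTime.comp_graphData`). -/

/-! ### The reduction from graphs to comparison data -/

/-- The bit in row `r`, column `c` of the adjacency matrix, extended by `false`. -/
noncomputable def adjBit {n : ℕ} (G : SimpleGraph (Fin n)) (r c : ℕ) : Bool :=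
  open scoped Classical in
  if h : r < n ∧ c < n then decide (G.Adj ⟨r, h.1⟩ ⟨c, h.2⟩) else false

/-- The sample obtained from the edges between even and odd vertices: item `i` owns the vertices
`2 * i` and `2 * i + 1`; the sample `false` compares `i < j` by the edge between `2 * i` and
`2 * j + 1`, the sample `true` by the edge between `2 * i + 1` and `2 * j`. -/
noncomputable def graphSample {n : ℕ} (G : SimpleGraph (Fin n)) (b : Bool) (i j : ℕ) : Bool :=
  decide (i < j) && adjBit G (2 * i + b.toNat) (2 * j + (!b).toNat)

/-- The comparison data extracted from a graph. -/
noncomputable def graphData (G : Σ n, SimpleGraph (Fin n)) : ComparisonData :=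
  ⟨G.1 / 2, fun i j => graphSample G.2 false i j, fun i j => graphSample G.2 true i j⟩

/-- Consecutive rows `r, …, r + k - 1` of a bit matrix with `n` columns, each closed by `none`. -/
def encodeRows (n : ℕ) (m : ℕ → ℕ → Bool) : ℕ → ℕ → List (Option Bool)
  | _, 0 => []
  | r, k + 1 => (List.range' 0 n).map (fun c => some (m r c)) ++ none :: encodeRows n m (r + 1) k

/-- The definition peels off the first row, as the machine reads its input; its output grows by a
last row. -/
theorem encodeRows_succ_last (n : ℕ) (m : ℕ → ℕ → Bool) (r k : ℕ) :
    encodeRows n m r (k + 1) =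
      encodeRows n m r k ++ ((List.range' 0 n).map (fun c => some (m (r + k) c)) ++ [none]) := by
  induction k generalizing r with
  | zero => simp [encodeRows]
  | succ k ih =>
    rw [encodeRows, ih (r + 1)]
    conv_rhs => rw [encodeRows]
    simp [add_assoc, add_comm 1 k]

/-- With natural-number indices and a movable first row, the unread part of the input has the same
form as the whole. -/
theorem flatten_ofFn_rows {n : ℕ} (m : ℕ → ℕ → Bool) (k : ℕ) (r : ℕ) :
    (List.ofFn fun i : Fin k =>
      (List.ofFn fun j : Fin n => some (m (r + i) j)) ++ [none]).flatten = encodeRows n m r k := by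
  induction k generalizing r with
  | zero => simp [encodeRows]
  | succ k ih =>
    have h : (List.ofFn fun j : Fin n => some (m r j)) =
        (List.range' 0 n).map (fun c => some (m r c)) := by
      apply List.ext_getElem <;> simp
    rw [List.ofFn_succ, List.flatten_cons, encodeRows, ← ih (r + 1)]
    simp [h, add_assoc, add_comm 1]

theorem encodeBitMatrix_eq_encodeRows {n : ℕ} (m : ℕ → ℕ → Bool) :
    (encodeBitMatrix fun i j : Fin n => m i j) = encodeRows n m 0 n := by
  rw [← flatten_ofFn_rows]; simp [encodeBitMatrix]

theorem length_encodeRows (n : ℕ) (m : ℕ → ℕ → Bool) (r k : ℕ) :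
    (encodeRows n m r k).length = k * (n + 1) := by
  induction k generalizing r with
  | zero => simp [encodeRows]
  | succ k ih => simp [encodeRows, ih]; ring

theorem encodeGraph_eq_encodeRows {n : ℕ} (G : SimpleGraph (Fin n)) :
    encodeGraph G = encodeRows n (adjBit G) 0 n := by
  rw [← encodeBitMatrix_eq_encodeRows, encodeGraph]
  congr; funext i j
  simp [adjBit]

theorem encodeComparisonData_graphData (G : Σ n, SimpleGraph (Fin n)) :
    encodeComparisonData (graphData G) =
      encodeRows (G.1 / 2) (graphSample G.2 false) 0 (G.1 / 2) ++
        encodeRows (G.1 / 2) (graphSample G.2 true) 0 (G.1 / 2) := by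
  rw [← encodeBitMatrix_eq_encodeRows, ← encodeBitMatrix_eq_encodeRows]
  rfl

/-! ### Running a stack machine -/

/-- The deterministic step function `f` leads from `a` to `b` in at most `t` steps. -/
def RunsWithin {α : Type*} (f : α → Option α) (a b : α) (t : ℕ) : Prop :=
  ∃ s ≤ t, (flip Bind.bind f)^[s] (some a) = some b

namespace RunsWithin

variable {α : Type*} {f : α → Option α} {a b c : α} {s t : ℕ}

theorem refl : RunsWithin f a a t := ⟨0, zero_le, rfl⟩

theorem trans (h : RunsWithin f a b s) (h' : RunsWithin f b c t) : RunsWithin f a c (s + t) := by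
  obtain ⟨m, hm, e⟩ := h
  obtain ⟨m', hm', e'⟩ := h'
  exact ⟨m' + m, by omega, by rw [Function.iterate_add_apply, e, e']⟩

theorem mono (h : RunsWithin f a b s) (hst : s ≤ t) : RunsWithin f a b t := by
  obtain ⟨m, hm, e⟩ := h
  exact ⟨m, hm.trans hst, e⟩

theorem head (h : f a = some b) (h' : RunsWithin f b c t) : RunsWithin f a c (t + 1) := by
  obtain ⟨m, hm, e⟩ := h'
  exact ⟨m + 1, by omega, by rw [Function.iterate_succ_apply]; simpa [flip, h] using e⟩

theorem single (h : f a = some b) : RunsWithin f a b 1 := head h (refl (t := 0))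

end RunsWithin

/-! ### The machine that performs the reduction and then runs a test -/

namespace Reduction

open Turing

/-- The additional stacks: the input, two stacks of tokens and the two samples in reverse. -/
inductive Stk
  | inp | tok (b : Bool) | acc (b : Bool)
  deriving DecidableEq, Fintype

/-- The labels of the reduction. -/
inductive Lab
  | start | row (b : Bool) | disc | clean | pour (b : Bool)
  deriving DecidableEq, Fintype

/-- The three symbols read last. -/
abbrev Mem : Type := Option (Option Bool) × Option (Option Bool) × Option (Option Bool)

variable (tm : FinTM2)

/-- The alphabets of the combined machine. -/
abbrev Alph : tm.K ⊕ Stk → Type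
  | .inl k => tm.Γ k
  | .inr _ => Option Bool

/-- The internal states of the combined machine. -/
abbrev State : Type := tm.σ × Mem

/-- Statements of the combined machine. -/
abbrev CStmt : Type := TM2.Stmt (Alph tm) (Lab ⊕ tm.Λ) (State tm)

instance : DecidableEq (tm.K ⊕ Stk) :=
  haveI := tm.kDecidableEq
  inferInstance

variable {tm}

/-- A statement of `tm` as a statement of the combined machine. -/
def liftStmt : TM2.Stmt tm.Γ tm.Λ tm.σ → CStmt tm
  | .push k f q => .push (Sum.inl k) (fun s => f s.1) (liftStmt q)
  | .peek k f q => .peek (Sum.inl k) (fun s x => (f s.1 x, s.2)) (liftStmt q)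
  | .pop k f q => .pop (Sum.inl k) (fun s x => (f s.1 x, s.2)) (liftStmt q)
  | .load a q => .load (fun s => (a s.1, s.2)) (liftStmt q)
  | .branch f q₁ q₂ => .branch (fun s => f s.1) (liftStmt q₁) (liftStmt q₂)
  | .goto l => .goto fun s => Sum.inr (l s.1)
  | .halt => .halt

/-- The empty memory. -/
def noMem : Mem := (none, none, none)

/-- Clear the memory and go to the label `l`. -/
def next (l : Lab ⊕ tm.Λ) : CStmt tm :=
  .load (fun s => (s.1, noMem)) (.goto fun _ => l)

/-- Close the current row of the sample `b`. -/
def endRow (b : Bool) : CStmt tm :=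
  .push (Sum.inr (.acc b)) (fun _ => (none : Option Bool)) <|
    if b then .push (Sum.inr (.tok false)) (fun _ => (none : Option Bool)) (next (Sum.inl (.row false)))
    else next (Sum.inl (.row true))

/-- The program of the reduction. -/
def program (e : tm.Γ tm.k₀ ≃ Option Bool) : Lab → CStmt tm
  | .start => .push (Sum.inr (.tok false)) (fun _ => (none : Option Bool)) (next (Sum.inl (.row false)))
  -- In a row of item `i` the active token stack starts with `i + 1` tokens. Each pair of columns
  -- `2j, 2j+1` moves one token to the other stack and outputs `false`, which covers `j ≤ i`; once
  -- the tokens are used up, the relevant bit of the pair is copied. An unpaired last column is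
  -- dropped.
  | .row b =>
    .pop (Sum.inr .inp) (fun s x => (s.1, x, none, none)) <|
    -- End of input. At `.row true` an unpaired last row has just been recorded in the first sample:
    -- its separator is removed here, its bits at `.disc`.
    .branch (fun s => s.2.1.isNone)
      (if b then .pop (Sum.inr (.acc false)) (fun s _ => s) (next (Sum.inl .disc))
        else next (Sum.inl .disc)) <|
    .branch (fun s => s.2.1.join.isNone) (endRow b) <|
    .pop (Sum.inr .inp) (fun s x => (s.1, s.2.1, x, none)) <|
    .branch (fun s => s.2.2.1.join.isNone) (endRow b) <|
    .pop (Sum.inr (.tok b)) (fun s x => (s.1, s.2.1, s.2.2.1, x)) <|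
    .branch (fun s => s.2.2.2.isSome)
      (.push (Sum.inr (.acc b)) (fun _ => (some false : Option Bool)) <|
        .push (Sum.inr (.tok !b)) (fun _ => (none : Option Bool)) (next (Sum.inl (.row b))))
      (.push (Sum.inr (.acc b)) (fun s => if b then s.2.1.join else s.2.2.1.join)
        (next (Sum.inl (.row b))))
  -- The tokens moved during the spurious row count its outcomes, so one outcome is removed per
  -- token.
  | .disc =>
    .pop (Sum.inr (.tok true)) (fun s x => (s.1, x, none, none)) <|
    .branch (fun s => s.2.1.isSome)
      (.pop (Sum.inr (.acc false)) (fun s _ => s) (next (Sum.inl .disc)))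
      (next (Sum.inl .clean))
  | .clean =>
    .pop (Sum.inr (.tok false)) (fun s x => (s.1, x, none, none)) <|
    .branch (fun s => s.2.1.isSome) (next (Sum.inl .clean)) (next (Sum.inl (.pour true)))
  -- Pouring undoes the reversal of the samples. The second sample goes first, since what is pushed
  -- last is read first.
  | .pour b =>
    .pop (Sum.inr (.acc b)) (fun s x => (s.1, x, none, none)) <|
    .branch (fun s => s.2.1.isSome)
      (.push (Sum.inl tm.k₀) (fun s => e.symm s.2.1.join) (next (Sum.inl (.pour b))))
      (next (if b then Sum.inl (.pour false) else Sum.inr tm.main))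

/-- The combined machine. -/
def machine (e : tm.Γ tm.k₀ ≃ Option Bool) : FinTM2 :=
  haveI := tm.kFin
  haveI := tm.ΛFin
  haveI := tm.σFin
  { K := tm.K ⊕ Stk
    k₀ := Sum.inr .inp
    k₁ := Sum.inl tm.k₁
    Γ := Alph tm
    Λ := Lab ⊕ tm.Λ
    main := Sum.inl .start
    σ := State tm
    initialState := (tm.initialState, noMem)
    Γk₀Fin := inferInstanceAs (Fintype (Option Bool))
    m := Sum.elim (program e) fun l => liftStmt (tm.m l) }

/-- The step function of the combined machine. -/
abbrev cstep (e : tm.Γ tm.k₀ ≃ Option Bool) :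
    TM2.Cfg (Alph tm) (Lab ⊕ tm.Λ) (State tm) → Option (TM2.Cfg (Alph tm) (Lab ⊕ tm.Λ) (State tm)) :=
  TM2.step (Sum.elim (program e) fun l => liftStmt (tm.m l))

/-- The stacks of the combined machine, given separately. -/
def allStk (S : ∀ k, List (tm.Γ k)) (I T F X Y : List (Option Bool)) :
    ∀ k, List (Alph tm k)
  | .inl k => S k
  | .inr .inp => I
  | .inr (.tok false) => T
  | .inr (.tok true) => F
  | .inr (.acc false) => X
  | .inr (.acc true) => Y

/-- A configuration of `tm` as a configuration of the combined machine. -/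
def liftCfg (c : TM2.Cfg tm.Γ tm.Λ tm.σ) : TM2.Cfg (Alph tm) (Lab ⊕ tm.Λ) (State tm) :=
  ⟨c.l.map Sum.inr, (c.var, noMem), allStk c.stk [] [] [] [] []⟩

section update

variable (S : ∀ k, List (tm.Γ k)) (I T F X Y L : List (Option Bool))

@[simp] theorem update_inl (k : tm.K) (l : List (tm.Γ k)) :
    Function.update (allStk S I T F X Y) (Sum.inl k) l =
      allStk (haveI := tm.kDecidableEq; Function.update S k l) I T F X Y := by
  let := tm.kDecidableEq
  funext k'
  rcases k' with k' | (_ | (_ | _) | (_ | _))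
  · by_cases h : k' = k
    · subst h; simp [allStk]
    · simp [allStk, h]
  all_goals simp [allStk]

@[simp] theorem update_inp :
    Function.update (allStk S I T F X Y) (Sum.inr .inp) L = allStk S L T F X Y := by
  funext k'; rcases k' with k' | (_ | (_ | _) | (_ | _)) <;> simp [allStk]

@[simp] theorem update_tok_false :
    Function.update (allStk S I T F X Y) (Sum.inr (.tok false)) L = allStk S I L F X Y := by
  funext k'; rcases k' with k' | (_ | (_ | _) | (_ | _)) <;> simp [allStk]

@[simp] theorem update_tok_true :
    Function.update (allStk S I T F X Y) (Sum.inr (.tok true)) L = allStk S I T L X Y := by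
  funext k'; rcases k' with k' | (_ | (_ | _) | (_ | _)) <;> simp [allStk]

@[simp] theorem update_acc_false :
    Function.update (allStk S I T F X Y) (Sum.inr (.acc false)) L = allStk S I T F L Y := by
  funext k'; rcases k' with k' | (_ | (_ | _) | (_ | _)) <;> simp [allStk]

@[simp] theorem update_acc_true :
    Function.update (allStk S I T F X Y) (Sum.inr (.acc true)) L = allStk S I T F X L := by
  funext k'; rcases k' with k' | (_ | (_ | _) | (_ | _)) <;> simp [allStk]

@[simp] theorem allStk_inl (k : tm.K) : allStk S I T F X Y (Sum.inl k) = S k := rfl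
@[simp] theorem allStk_inp : allStk S I T F X Y (Sum.inr .inp) = I := rfl
@[simp] theorem allStk_tok_false : allStk S I T F X Y (Sum.inr (.tok false)) = T := rfl
@[simp] theorem allStk_tok_true : allStk S I T F X Y (Sum.inr (.tok true)) = F := rfl
@[simp] theorem allStk_acc_false : allStk S I T F X Y (Sum.inr (.acc false)) = X := rfl
@[simp] theorem allStk_acc_true : allStk S I T F X Y (Sum.inr (.acc true)) = Y := rfl

end update

/-- A lifted statement touches neither the memory nor the additional stacks, so both stay empty
throughout the simulation. -/
theorem stepAux_liftStmt (q : TM2.Stmt tm.Γ tm.Λ tm.σ) (v : tm.σ) (S : ∀ k, List (tm.Γ k)) :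
    TM2.stepAux (liftStmt q) (v, noMem) (allStk S [] [] [] [] []) =
      liftCfg (TM2.stepAux q v S) := by
  induction q generalizing v S with
  | push k f q ih => simp [liftStmt, ih]
  | peek k f q ih => simp [liftStmt, ih]
  | pop k f q ih => simp [liftStmt, ih]
  | load a q ih => simp [liftStmt, ih]
  | branch f q₁ q₂ ih₁ ih₂ =>
    cases h : f v <;> simp [liftStmt, ih₁, ih₂, h]
  | goto l => simp [liftStmt, liftCfg]
  | halt => simp [liftStmt, liftCfg]

theorem cstep_liftCfg (e : tm.Γ tm.k₀ ≃ Option Bool) (c : TM2.Cfg tm.Γ tm.Λ tm.σ) :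
    cstep e (liftCfg c) = (TM2.step tm.m c).map liftCfg := by
  obtain ⟨_ | l, v, S⟩ := c
  · simp [liftCfg, cstep]
  · simp only [liftCfg, cstep, Option.map_some, TM2.step, Sum.elim_inr]
    rw [stepAux_liftStmt]; rfl

theorem RunsWithin.liftCfg (e : tm.Γ tm.k₀ ≃ Option Bool) {c c' : TM2.Cfg tm.Γ tm.Λ tm.σ} {t : ℕ}
    (h : RunsWithin (TM2.step tm.m) c c' t) :
    RunsWithin (cstep e) (Reduction.liftCfg c) (Reduction.liftCfg c') t := by
  obtain ⟨s, hs, h⟩ := h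
  refine ⟨s, hs, ?_⟩
  have key : ∀ (s : ℕ) (o : Option (TM2.Cfg tm.Γ tm.Λ tm.σ)),
      (flip Bind.bind (cstep e))^[s] (o.map Reduction.liftCfg) =
        ((flip Bind.bind (TM2.step tm.m))^[s] o).map Reduction.liftCfg := by
    intro s
    induction s with
    | zero => simp
    | succ s ih =>
      intro o
      rw [Function.iterate_succ_apply, Function.iterate_succ_apply, ← ih]
      congr 1
      cases o with
      | none => rfl
      | some c => exact cstep_liftCfg e c
  simpa only [h, Option.map_some] using key s (some c)

end Reduction

/-! ### Correctness and running time of the reduction program -/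

namespace Reduction

open Turing

variable {tm : FinTM2} (e : tm.Γ tm.k₀ ≃ Option Bool)

variable (tm) in
/-- A configuration during the reduction. -/
def conf (l : Lab) (I T F X Y : List (Option Bool)) :
    TM2.Cfg (Alph tm) (Lab ⊕ tm.Λ) (State tm) :=
  ⟨some (Sum.inl l), (tm.initialState, noMem), allStk (fun _ => []) I T F X Y⟩

variable (tm) in
/-- A configuration inside a row of the sample `b`, with token stacks `t` (active) and `s`, and
sample stacks `A` (active) and `A'`. -/
def rowConf (b : Bool) (I t s A A' : List (Option Bool)) :
    TM2.Cfg (Alph tm) (Lab ⊕ tm.Λ) (State tm) :=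
  if b then conf tm (.row true) I s t A' A else conf tm (.row false) I t s A A'

variable (tm) in
/-- The configuration after a row of the sample `b`. -/
def endConf (b : Bool) (I t s A A' : List (Option Bool)) :
    TM2.Cfg (Alph tm) (Lab ⊕ tm.Λ) (State tm) :=
  rowConf tm (!b) I (bif b then none :: s else s) t A' (none :: A)

@[simp] theorem update_tok_not_true (S : ∀ k, List (tm.Γ k)) (I T F X Y L : List (Option Bool)) :
    Function.update (allStk S I T F X Y) (Sum.inr (.tok !true)) L = allStk S I L F X Y :=
  update_tok_false S I T F X Y L

@[simp] theorem update_tok_not_false (S : ∀ k, List (tm.Γ k)) (I T F X Y L : List (Option Bool)) :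
    Function.update (allStk S I T F X Y) (Sum.inr (.tok !false)) L = allStk S I T L X Y :=
  update_tok_true S I T F X Y L

@[simp] theorem allStk_tok_not_true (S : ∀ k, List (tm.Γ k)) (I T F X Y : List (Option Bool)) :
    allStk S I T F X Y (Sum.inr (.tok !true)) = T := rfl

@[simp] theorem allStk_tok_not_false (S : ∀ k, List (tm.Γ k)) (I T F X Y : List (Option Bool)) :
    allStk S I T F X Y (Sum.inr (.tok !false)) = F := rfl

theorem step_row_token (b x y : Bool) (c : Option Bool) (I t s A A' : List (Option Bool)) :
    cstep e (rowConf tm b (some x :: some y :: I) (c :: t) s A A') =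
      some (rowConf tm b I t (none :: s) (some false :: A) A') := by
  cases b <;> simp [cstep, rowConf, conf, program, next]

theorem step_row_bit (b x y : Bool) (I s A A' : List (Option Bool)) :
    cstep e (rowConf tm b (some x :: some y :: I) [] s A A') =
      some (rowConf tm b I [] s (some (if b then x else y) :: A) A') := by
  cases b <;> simp [cstep, rowConf, conf, program, next]

theorem step_row_end (b : Bool) (I t s A A' : List (Option Bool)) :
    cstep e (rowConf tm b (none :: I) t s A A') = some (endConf tm b I t s A A') := by
  cases b <;> simp [cstep, rowConf, endConf, conf, program, next, endRow]

theorem step_row_end_odd (b x : Bool) (I t s A A' : List (Option Bool)) :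
    cstep e (rowConf tm b (some x :: none :: I) t s A A') = some (endConf tm b I t s A A') := by
  cases b <;> simp [cstep, rowConf, endConf, conf, program, next, endRow]

/-- The outcomes of item `i` against the items below `j`, read off the bits `f`. -/
def rowBits (b : Bool) (i : ℕ) (f : ℕ → Bool) (j : ℕ) : List (Option Bool) :=
  (List.range' 0 j).map fun j => some (decide (i < j) && f (2 * j + (!b).toNat))

theorem rowBits_succ (b : Bool) (i : ℕ) (f : ℕ → Bool) (j : ℕ) (A : List (Option Bool)) :
    (rowBits b i f (j + 1)).reverse ++ A =
      some (decide (i < j) && f (2 * j + (!b).toNat)) :: ((rowBits b i f j).reverse ++ A) := by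
  simp [rowBits, List.range'_concat]

/-- Loop invariant before column `2 * j`: `min j (i + 1)` tokens have been moved, and the outcomes
against items below `j` are written. The recursion consumes two columns at a time; its two base
cases are an exhausted row and a single unpaired column. -/
theorem runs_row (b : Bool) (i : ℕ) (f : ℕ → Bool) (I A A' : List (Option Bool)) :
    ∀ len j : ℕ, RunsWithin (cstep e)
      (rowConf tm b ((List.range' (2 * j) len).map (fun c => some (f c)) ++ none :: I)
        (List.replicate (i + 1 - j) none) (List.replicate (min j (i + 1)) none)
        ((rowBits b i f j).reverse ++ A) A')
      (endConf tm b I (List.replicate (i + 1 - (j + len / 2)) none)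
        (List.replicate (min (j + len / 2) (i + 1)) none)
        ((rowBits b i f (j + len / 2)).reverse ++ A) A') (len / 2 + 1)
  | 0, j => by simpa using RunsWithin.single (step_row_end e b _ _ _ _ _)
  | 1, j => by simpa using RunsWithin.single (step_row_end_odd e b _ _ _ _ _ _)
  | len + 2, j => by
    have ih := runs_row b i f I A A' len (j + 1)
    have h1 : (len + 2) / 2 = len / 2 + 1 := by omega
    have h2 : j + (len / 2 + 1) = j + 1 + len / 2 := by omega
    rw [h1, h2]
    refine RunsWithin.head ?_ ih
    rw [rowBits_succ]
    have hr : (List.range' (2 * j) (len + 2)).map (fun c => some (f c)) ++ none :: I =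
        some (f (2 * j)) :: some (f (2 * j + 1)) ::
          ((List.range' (2 * (j + 1)) len).map (fun c => some (f c)) ++ none :: I) := by
      simp [List.range'_succ, mul_add, add_assoc]
    rw [hr]
    rcases Nat.lt_or_ge i j with hij | hij
    · have e1 : i + 1 - j = 0 := by omega
      have e2 : i + 1 - (j + 1) = 0 := by omega
      have e3 : min (j + 1) (i + 1) = min j (i + 1) := by omega
      rw [e1, e2, e3, List.replicate_zero, step_row_bit]
      cases b <;> simp [hij]
    · have e1 : i + 1 - j = (i + 1 - (j + 1)) + 1 := by omega
      have e3 : min (j + 1) (i + 1) = min j (i + 1) + 1 := by omega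
      rw [e1, e3, List.replicate_succ, step_row_token, ← List.replicate_succ]
      simp [Nat.not_lt.2 hij]

theorem runs_full_row (b : Bool) (i n : ℕ) (f : ℕ → Bool) (I A A' : List (Option Bool)) :
    RunsWithin (cstep e)
      (rowConf tm b ((List.range' 0 n).map (fun c => some (f c)) ++ none :: I)
        (List.replicate (i + 1) none) [] A A')
      (endConf tm b I (List.replicate (i + 1 - n / 2) none)
        (List.replicate (min (n / 2) (i + 1)) none)
        ((rowBits b i f (n / 2)).reverse ++ A) A') (n / 2 + 1) := by
  simpa [rowBits] using runs_row (tm := tm) e b i f I A A' n 0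

/-- Row `i` of the sample `b` extracted from the bit matrix `m`. -/
def sampleOf (m : ℕ → ℕ → Bool) (b : Bool) (i j : ℕ) : Bool :=
  decide (i < j) && m (2 * i + b.toNat) (2 * j + (!b).toNat)

/-- As `i < n / 2`, the first row moves all `i + 1` tokens across and the second moves them back;
closing the second row adds the token needed for item `i + 1`. -/
theorem runs_two_rows (n i : ℕ) (hi : i < n / 2) (m : ℕ → ℕ → Bool)
    (k : ℕ) :
    RunsWithin (cstep e)
      (conf tm (.row false) (encodeRows n m (2 * i) (k + 2))
        (List.replicate (i + 1) none) []
        (encodeRows (n / 2) (sampleOf m false) 0 i).reverse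
        (encodeRows (n / 2) (sampleOf m true) 0 i).reverse)
      (conf tm (.row false) (encodeRows n m (2 * (i + 1)) k)
        (List.replicate (i + 2) none) []
        (encodeRows (n / 2) (sampleOf m false) 0 (i + 1)).reverse
        (encodeRows (n / 2) (sampleOf m true) 0 (i + 1)).reverse) (n + 2) := by
  have h1 := runs_full_row (tm := tm) e false i n (m (2 * i)) (encodeRows n m (2 * i + 1) (k + 1))
    (encodeRows (n / 2) (sampleOf m false) 0 i).reverse
    (encodeRows (n / 2) (sampleOf m true) 0 i).reverse
  have h2 := runs_full_row (tm := tm) e true i n (m (2 * i + 1)) (encodeRows n m (2 * i + 1 + 1) k)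
    (encodeRows (n / 2) (sampleOf m true) 0 i).reverse
    (encodeRows (n / 2) (sampleOf m false) 0 (i + 1)).reverse
  have e1 : i + 1 - n / 2 = 0 := by omega
  have e2 : min (n / 2) (i + 1) = i + 1 := by omega
  have hX : ∀ b, (encodeRows (n / 2) (sampleOf m b) 0 (i + 1)).reverse =
      none :: ((rowBits b i (m (2 * i + b.toNat)) (n / 2)).reverse ++
        (encodeRows (n / 2) (sampleOf m b) 0 i).reverse) := by
    intro b
    rw [encodeRows_succ_last]
    simp [rowBits, sampleOf]
  rw [e1, e2] at h1 h2
  refine RunsWithin.mono (h1.trans ?_) (t := n + 2) (s := (n / 2 + 1) + (n / 2 + 1)) (by omega)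
  convert h2 using 1
  · rw [hX]; simp [endConf, rowConf, encodeRows]
  · simp [endConf, rowConf, hX, mul_add, List.replicate_succ]

theorem runs_rows (n : ℕ) (m : ℕ → ℕ → Bool) :
    ∀ k i : ℕ, i + k = n / 2 → RunsWithin (cstep e)
      (conf tm (.row false) (encodeRows n m (2 * i) (n % 2 + 2 * k))
        (List.replicate (i + 1) none) []
        (encodeRows (n / 2) (sampleOf m false) 0 i).reverse
        (encodeRows (n / 2) (sampleOf m true) 0 i).reverse)
      (conf tm (.row false) (encodeRows n m (2 * (n / 2)) (n % 2))
        (List.replicate (n / 2 + 1) none) []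
        (encodeRows (n / 2) (sampleOf m false) 0 (n / 2)).reverse
        (encodeRows (n / 2) (sampleOf m true) 0 (n / 2)).reverse) (k * (n + 2))
  | 0, i, hik => by
    obtain rfl : i = n / 2 := by omega
    exact RunsWithin.refl
  | k + 1, i, hik => by
    have h := runs_two_rows (tm := tm) e n i (by omega) m (n % 2 + 2 * k)
    have ih := runs_rows n m k (i + 1) (by omega)
    exact (h.trans ih).mono (by ring_nf; omega)

theorem runs_disc (L T X Y : List (Option Bool)) (c : ℕ) (hL : L.length = c) :
    RunsWithin (cstep e) (conf tm .disc [] T (List.replicate c none) (L ++ X) Y)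
      (conf tm .clean [] T [] X Y) (c + 1) := by
  induction c generalizing L with
  | zero =>
    obtain rfl := List.length_eq_zero_iff.1 hL
    exact RunsWithin.single (by simp [cstep, conf, program, next])
  | succ c ih =>
    obtain ⟨a, L, rfl⟩ := List.exists_cons_of_length_eq_add_one hL
    exact RunsWithin.head (by simp [cstep, conf, program, next, List.replicate_succ])
      (ih L (by simpa using hL))

theorem runs_clean (T X Y : List (Option Bool)) :
    RunsWithin (cstep e) (conf tm .clean [] T [] X Y)
      (conf tm (.pour true) [] [] [] X Y) (T.length + 1) := by
  induction T with
  | nil => exact RunsWithin.single (by simp [cstep, conf, program, next])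
  | cons a T ih => exact RunsWithin.head (by simp [cstep, conf, program, next]) ih

/-- For even `n` the input is exhausted and no token is on the second stack. For odd `n` the last
row is treated as one more row of the first sample, moving exactly `n / 2` tokens, as many as the
outcomes to discard. -/
theorem runs_leftover (n : ℕ) (m : ℕ → ℕ → Bool) (X Y : List (Option Bool)) :
    RunsWithin (cstep e)
      (conf tm (.row false) (encodeRows n m (2 * (n / 2)) (n % 2))
        (List.replicate (n / 2 + 1) none) [] X Y)
      (conf tm (.pour true) [] [] [] X Y) (2 * n + 5) := by
  rcases Nat.mod_two_eq_zero_or_one n with h | h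
  · have h1 : cstep e (conf tm (.row false) [] (List.replicate (n / 2 + 1) none) [] X Y) =
        some (conf tm .disc [] (List.replicate (n / 2 + 1) none) (List.replicate 0 none)
          ([] ++ X) Y) := by
      simp [cstep, conf, program, next]
    rw [h, encodeRows]
    refine RunsWithin.mono (RunsWithin.head h1 ((runs_disc e [] _ X Y 0 rfl).trans
      (runs_clean e _ X Y))) ?_
    simp; omega
  · have h0 := runs_full_row (tm := tm) e false (n / 2) n (m (2 * (n / 2))) [] X Y
    have h1 : cstep e (endConf tm false []
        (List.replicate (n / 2 + 1 - n / 2) none) (List.replicate (min (n / 2) (n / 2 + 1)) none)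
        ((rowBits false (n / 2) (m (2 * (n / 2))) (n / 2)).reverse ++ X) Y) =
        some (conf tm .disc [] (List.replicate (n / 2 + 1 - n / 2) none)
          (List.replicate (n / 2) none)
          ((rowBits false (n / 2) (m (2 * (n / 2))) (n / 2)).reverse ++ X) Y) := by
      simp [cstep, conf, endConf, rowConf, program, next]
    rw [h]
    refine RunsWithin.mono (h0.trans (RunsWithin.head h1 ((runs_disc e _ _ X Y (n / 2)
      (by simp [rowBits])).trans (runs_clean e _ X Y)))) ?_
    simp; omega

variable (tm) in
/-- The stacks of `tm` with the given input. -/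
def inputStk (W : List (tm.Γ tm.k₀)) : ∀ k, List (tm.Γ k) :=
  haveI := tm.kDecidableEq
  Function.update (fun _ => []) tm.k₀ W

variable (tm) in
/-- A configuration during the transfer of the samples to the input stack of `tm`. -/
def pourConf (l : Lab ⊕ tm.Λ) (W : List (tm.Γ tm.k₀)) (X Y : List (Option Bool)) :
    TM2.Cfg (Alph tm) (Lab ⊕ tm.Λ) (State tm) :=
  ⟨some l, (tm.initialState, noMem), allStk (inputStk tm W) [] [] [] X Y⟩

theorem runs_pour_true (W : List (tm.Γ tm.k₀)) (X Y : List (Option Bool)) :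
    RunsWithin (cstep e) (pourConf tm (.inl (.pour true)) W X Y)
      (pourConf tm (.inl (.pour false)) ((Y.map e.symm).reverse ++ W) X []) (Y.length + 1) := by
  induction Y generalizing W with
  | nil => exact RunsWithin.single (by simp [cstep, pourConf, program, next])
  | cons a Y ih =>
    refine RunsWithin.head ?_ (by simpa using ih (e.symm a :: W))
    simp [cstep, pourConf, program, next, inputStk]

theorem runs_pour_false (W : List (tm.Γ tm.k₀)) (X : List (Option Bool)) :
    RunsWithin (cstep e) (pourConf tm (.inl (.pour false)) W X [])
      (pourConf tm (.inr tm.main) ((X.map e.symm).reverse ++ W) [] []) (X.length + 1) := by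
  induction X generalizing W with
  | nil => exact RunsWithin.single (by simp [cstep, pourConf, program, next])
  | cons a X ih =>
    refine RunsWithin.head ?_ (by simpa using ih (e.symm a :: W))
    simp [cstep, pourConf, program, next, inputStk]

theorem inputStk_nil : inputStk tm [] = fun _ => [] := by
  simp [inputStk]

theorem initList_stk (W : List (tm.Γ tm.k₀)) : (initList tm W).stk = inputStk tm W := by
  let := tm.kDecidableEq
  funext k
  by_cases h : k = tm.k₀
  · subst h; simp [initList, inputStk]
  · simp [initList, inputStk, h]

theorem runs_reduction (n : ℕ) (m : ℕ → ℕ → Bool) :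
    RunsWithin (cstep e) (conf tm .start (encodeRows n m 0 n) [] [] [] [])
      (liftCfg (initList tm ((encodeRows (n / 2) (sampleOf m false) 0 (n / 2) ++
        encodeRows (n / 2) (sampleOf m true) 0 (n / 2)).map e.symm)))
      (2 * (n * (n + 1)) + 2 * n + 10) := by
  have h0 : cstep e (conf tm .start (encodeRows n m 0 n) [] [] [] []) =
      some (conf tm (.row false) (encodeRows n m (2 * 0) (n % 2 + 2 * (n / 2)))
        (List.replicate (0 + 1) none) []
        (encodeRows (n / 2) (sampleOf m false) 0 0).reverse
        (encodeRows (n / 2) (sampleOf m true) 0 0).reverse) := by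
    rw [Nat.mod_add_div]
    simp [cstep, conf, program, next, encodeRows]
  have h1 := runs_rows (tm := tm) e n m (n / 2) 0 (by omega)
  have h2 := runs_leftover (tm := tm) e n m
    (encodeRows (n / 2) (sampleOf m false) 0 (n / 2)).reverse
    (encodeRows (n / 2) (sampleOf m true) 0 (n / 2)).reverse
  have h3 := runs_pour_true (tm := tm) e []
    (encodeRows (n / 2) (sampleOf m false) 0 (n / 2)).reverse
    (encodeRows (n / 2) (sampleOf m true) 0 (n / 2)).reverse
  have h4 := runs_pour_false (tm := tm) e
    (((encodeRows (n / 2) (sampleOf m true) 0 (n / 2)).reverse.map e.symm).reverse ++ [])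
    (encodeRows (n / 2) (sampleOf m false) 0 (n / 2)).reverse
  have hc : ∀ X Y, conf tm (.pour true) [] [] [] X Y = pourConf tm (.inl (.pour true)) [] X Y := by
    intro X Y; rw [pourConf, inputStk_nil]; rfl
  rw [hc] at h2
  have hl : liftCfg (initList tm ((encodeRows (n / 2) (sampleOf m false) 0 (n / 2) ++
        encodeRows (n / 2) (sampleOf m true) 0 (n / 2)).map e.symm)) =
      pourConf tm (.inr tm.main) (((encodeRows (n / 2) (sampleOf m false) 0 (n / 2)).reverse.map
        e.symm).reverse ++ (((encodeRows (n / 2) (sampleOf m true) 0 (n / 2)).reverse.map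
          e.symm).reverse ++ [])) [] [] := by
    change (⟨some (Sum.inr tm.main), (tm.initialState, noMem),
      allStk (initList tm _).stk [] [] [] [] []⟩ : TM2.Cfg _ _ _) = _
    rw [initList_stk, pourConf]
    simp
  rw [hl]
  refine (RunsWithin.head h0 (h1.trans (h2.trans (h3.trans h4)))).mono ?_
  simp only [List.length_reverse, length_encodeRows]
  obtain ⟨q, hq⟩ : ∃ q, q = n / 2 := ⟨_, rfl⟩
  have : 2 * q ≤ n := by omega
  rw [← hq]
  nlinarith

/-- A halting configuration must have the initial state and empty stacks apart from the output;
hence the clearing of memory and tokens. -/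
theorem haltList_lift (W : List (tm.Γ tm.k₁)) :
    liftCfg (haltList tm W) = haltList (machine e) W := by
  let := tm.kDecidableEq
  have hs : (haltList (machine e) W).stk = allStk (haltList tm W).stk [] [] [] [] [] := by
    funext k
    rcases k with k | (_ | (_ | _) | (_ | _))
    · by_cases h : k = tm.k₁
      · subst h; simp [haltList, machine]; rfl
      · simp [haltList, machine, h]
    all_goals simp [haltList, machine]
  change (⟨none, (tm.initialState, noMem), allStk (haltList tm W).stk [] [] [] [] []⟩ :
    TM2.Cfg _ _ _) = _
  rw [← hs]
  rfl

theorem initList_machine (W : List (Option Bool)) :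
    initList (machine e) W = conf tm .start W [] [] [] [] := by
  have hs : (initList (machine e) W).stk = allStk (fun _ => []) W [] [] [] [] := by
    funext k
    rcases k with k | (_ | (_ | _) | (_ | _)) <;> simp [initList, machine]
    rfl
  rw [conf, ← hs]
  rfl

end Reduction

/-! ### Polynomial time is preserved by the reduction -/

theorem Polynomial.eval_mono_nat (p : Polynomial ℕ) {a b : ℕ} (h : a ≤ b) :
    p.eval a ≤ p.eval b := by
  rw [Polynomial.eval_eq_sum, Polynomial.eval_eq_sum]
  exact Finset.sum_le_sum fun i _ => Nat.mul_le_mul_left _ (Nat.pow_le_pow_left h i)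

/-- A polynomial-time question about comparison data, asked about the data extracted from a graph,
is a polynomial-time question about the graph. -/
theorem IsPolyTime.comp_graphData {f : ComparisonData → Bool}
    (hf : IsPolyTime encodeComparisonData f) :
    IsPolyTime (fun G : Σ n, SimpleGraph (Fin n) => encodeGraph G.2) (fun G => f (graphData G)) := by
  obtain ⟨h⟩ := hf
  refine ⟨{
    tm := Reduction.machine h.inputAlphabet
    inputAlphabet := Equiv.refl (Option Bool)
    outputAlphabet := h.outputAlphabet
    -- The input has length `L = n * (n + 1)`. The reduction takes at most `2 * L + 2 * n + 10 ≤ 4 *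
    -- L + 10` steps, and the data handed to the test have length at most `L`.
    time := h.time + 4 * Polynomial.X + 10
    outputsFun := fun G => Classical.choice ?_ }⟩
  have hrun := h.outputsFun (graphData G)
  have h1 := Reduction.runs_reduction (tm := h.tm) h.inputAlphabet G.1 (adjBit G.2)
  have h2 : RunsWithin (Turing.TM2.step h.tm.m)
      (Turing.initList h.tm ((encodeComparisonData (graphData G)).map h.inputAlphabet.symm))
      (Turing.haltList h.tm ((Computability.encodeBool (f (graphData G))).map
        h.outputAlphabet.symm)) (h.time.eval (encodeComparisonData (graphData G)).length) :=
    ⟨hrun.steps, hrun.steps_le_m, hrun.evals_in_steps⟩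
  have h3 := Reduction.RunsWithin.liftCfg h.inputAlphabet h2
  rw [encodeComparisonData_graphData] at h3
  obtain ⟨s, hs, hres⟩ := h1.trans h3
  refine ⟨⟨⟨s, ?_⟩, hs.trans ?_⟩⟩
  · rw [Reduction.haltList_lift h.inputAlphabet, ← Reduction.initList_machine h.inputAlphabet] at hres
    -- The input alphabet is translated by the identity, which has to be inserted to match the
    -- expected form.
    have hid : ∀ l, @List.map (Option Bool) (Option Bool) (Equiv.refl (Option Bool)).invFun l = l := List.map_id
    rw [encodeGraph_eq_encodeRows]
    rw [← hid (encodeRows _ _ _ _)] at hres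
    exact hres
  · rw [encodeGraph_eq_encodeRows]
    simp only [length_encodeRows, List.length_append, Polynomial.eval_add, Polynomial.eval_mul,
      Polynomial.eval_X, Polynomial.eval_ofNat]
    have hd : G.1 / 2 * (G.1 / 2 + 1) + G.1 / 2 * (G.1 / 2 + 1) ≤ G.1 * (G.1 + 1) := by
      obtain ⟨q, hq⟩ : ∃ q, q = G.1 / 2 := ⟨_, rfl⟩
      have : 2 * q ≤ G.1 := by omega
      rw [← hq]
      nlinarith
    have := h.time.eval_mono_nat hd
    nlinarith

/-! ### The law of the comparison data of a random graph -/

/-- The matrix in which item `i` surely beats item `j` if `i < j`, `A i` and `B j`, while all other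
comparisons are fair. -/
noncomputable def stairMatrix {d : ℕ} (A B : Fin d → Prop) : Matrix (Fin d) (Fin d) unitInterval :=
  open scoped Classical in
  fun i j => if i < j ∧ A i ∧ B j then 1 else if j < i ∧ A j ∧ B i then 0 else oneHalf

theorem symm_oneHalf : unitInterval.symm oneHalf = oneHalf := by
  ext; simp [oneHalf]; norm_num

theorem oneHalf_coe : (oneHalf : ℝ) = 1 / 2 := rfl

theorem exists_perm_of_key {d : ℕ} (key : Fin d → ℕ) :
    ∃ π : Equiv.Perm (Fin d), ∀ i j, π i < π j → key i ≤ key j := by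
  refine ⟨(Tuple.sort key).symm, fun i j h => ?_⟩
  simpa using Tuple.monotone_sort key h.le

theorem isSST_stairMatrix {d : ℕ} {A B : Fin d → Prop} (hAB : ∀ i, ¬(A i ∧ B i)) :
    IsSST (stairMatrix A B) := by
  classical
  constructor
  · intro i j
    unfold stairMatrix
    split_ifs with h1 h2 h3 <;>
      first
        | exact absurd h1.1 (not_lt.2 h2.1.le)
        | simp [symm_oneHalf]
  -- Ranking: `A` by increasing index, then the neutral items, then `B` by increasing index. Within
  -- `A` a larger index leaves fewer sure wins, within `B` it brings more sure losses.
  · obtain ⟨π, hπ⟩ := exists_perm_of_key fun i : Fin d =>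
      if A i then (i : ℕ) else if B i then 2 * d + i else d
    refine ⟨π, fun i j hij l => ?_⟩
    have hk := hπ i j hij
    have hi := i.2
    have hj := j.2
    have hA : A j → A i ∧ i ≤ j := by
      intro h
      rw [if_pos h] at hk
      split_ifs at hk with h1 h2
      · exact ⟨h1, hk⟩
      all_goals omega
    have hB : B i → B j ∧ i ≤ j := by
      intro h
      rw [if_neg fun h' => hAB i ⟨h', h⟩, if_pos h] at hk
      split_ifs at hk with h1 h2
      · omega
      · exact ⟨h2, by omega⟩
      · omega
    simp only [stairMatrix]
    by_cases h1 : i < l ∧ A i ∧ B l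
    · rw [if_pos h1]; exact unitInterval.le_one'
    rw [if_neg h1]
    by_cases h2 : l < i ∧ A l ∧ B i
    · obtain ⟨hBj, hle⟩ := hB h2.2.2
      rw [if_pos h2, if_neg fun h => hAB j ⟨h.2.1, hBj⟩, if_pos ⟨h2.1.trans_le hle, h2.2.1, hBj⟩]
    rw [if_neg h2, if_neg fun h => h1 ⟨(hA h.2.1).2.trans_lt h.1, (hA h.2.1).1, h.2.2⟩]
    split_ifs
    · exact unitInterval.nonneg'
    · exact le_rfl

/-- The vertex `2 * i + b` in a graph with `n` vertices. -/
def itemVertex {n : ℕ} (b : Bool) (i : Fin (n / 2)) : Fin n :=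
  ⟨2 * i + b.toNat, by have := i.2; cases b <;> simp <;> omega⟩

theorem SimpleGraph.binomialRandom_eq_map_infinitePi (V : Type*) [Countable V] (p : unitInterval) :
    SimpleGraph.binomialRandom V p =
      (Measure.infinitePi fun e : Sym2 V => unitInterval.toNNReal p • Measure.dirac (¬ e.IsDiag) +
        unitInterval.toNNReal (unitInterval.symm p) • Measure.dirac False).map
        fun x => SimpleGraph.fromEdgeSet {e | x e} := by
  rw [SimpleGraph.binomialRandom_eq_map, setBernoulli_eq_map, Measure.map_map]
  · rfl
  · exact SimpleGraph.measurable_fromEdgeSet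
  · exact MeasurableEquiv.setOfPred.measurable

theorem graphSample_eq {n : ℕ} (G : SimpleGraph (Fin n)) (b : Bool) (i j : Fin (n / 2)) :
    graphSample G b i j = (open scoped Classical in
      decide (i < j ∧ G.Adj (itemVertex b i) (itemVertex (!b) j))) := by
  have h1 := (itemVertex (n := n) b i).2
  have h2 := (itemVertex (n := n) (!b) j).2
  simp only [itemVertex] at h1 h2
  classical
  rw [Bool.eq_iff_iff, decide_eq_true_iff]
  simp [graphSample, adjBit, h1, h2, itemVertex]

theorem itemVertex_injective {n : ℕ} {b b' : Bool} {i j : Fin (n / 2)}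
    (h : itemVertex (n := n) b i = itemVertex b' j) : b = b' ∧ i = j := by
  simp only [itemVertex, Fin.mk.injEq] at h
  cases b <;> cases b' <;> simp at h ⊢ <;> omega

/-- The edge used for the comparison of `i` and `j` in the sample `b`. -/
def sampleEdge {n : ℕ} (k : Bool × Fin (n / 2) × Fin (n / 2)) : Sym2 (Fin n) :=
  s(itemVertex k.1 k.2.1, itemVertex (!k.1) k.2.2)

/-- The endpoints have opposite parity and determine the items; a match with swapped endpoints would
reverse `i < j`. -/
theorem sampleEdge_injOn {n : ℕ} {k k' : Bool × Fin (n / 2) × Fin (n / 2)}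
    (hk : k.2.1 < k.2.2) (hk' : k'.2.1 < k'.2.2)
    (h : (sampleEdge k : Sym2 (Fin n)) = sampleEdge k') : k = k' := by
  obtain ⟨b, i, j⟩ := k
  obtain ⟨b', i', j'⟩ := k'
  simp only [sampleEdge, Sym2.eq_iff] at h
  rcases h with ⟨h1, h2⟩ | ⟨h1, h2⟩
  · obtain ⟨rfl, rfl⟩ := itemVertex_injective h1
    obtain ⟨-, rfl⟩ := itemVertex_injective h2
    rfl
  · obtain ⟨rfl, rfl⟩ := itemVertex_injective h1
    obtain ⟨-, rfl⟩ := itemVertex_injective h2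
    exact absurd hk (not_lt.2 hk'.le)

instance (V : Type*) [Countable V] : MeasurableSingletonClass (SimpleGraph V) where
  measurableSet_singleton G := by
    have : ({G} : Set (SimpleGraph V)) = SimpleGraph.edgeSet ⁻¹' {G.edgeSet} := by ext; simp
    rw [this]
    exact SimpleGraph.measurableEmbedding_edgeSet.measurable (measurableSet_singleton _)

section law

variable {n : ℕ} (S : Finset (Fin n))

/-- The items whose vertex of type `b` belongs to `S`. -/
def plantedItems (b : Bool) (i : Fin (n / 2)) : Prop := itemVertex b i ∈ S

/-- The matrix of comparison probabilities of the sample `b` when a clique is planted on `S`. -/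
noncomputable def plantedMatrix (b : Bool) : Matrix (Fin (n / 2)) (Fin (n / 2)) unitInterval :=
  stairMatrix (plantedItems S b) (plantedItems S !b)

theorem graphSample_plantClique (G : SimpleGraph (Fin n)) (b : Bool) (i j : Fin (n / 2)) :
    graphSample (plantClique G S) b i j = (open scoped Classical in
      decide (i < j ∧ (sampleEdge (b, i, j) ∈ G.edgeSet ∨
        plantedItems S b i ∧ plantedItems S (!b) j))) := by
  have hne : itemVertex (n := n) b i ≠ itemVertex (!b) j := by
    intro h; have := (itemVertex_injective h).1; cases b <;> simp at this
  rw [graphSample_eq]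
  simp only [plantClique, sampleEdge, plantedItems]
  refine decide_eq_decide.2 (and_congr_right fun _ => ?_)
  rw [SimpleGraph.sup_adj, SimpleGraph.fromRel_adj, SimpleGraph.mem_edgeSet]
  tauto

theorem map_graphSample :
    (SimpleGraph.binomialRandom (Fin n) oneHalf).map (fun G =>
      ((fun i j : Fin (n / 2) => graphSample (plantClique G S) false i j),
        (fun i j : Fin (n / 2) => graphSample (plantClique G S) true i j))) =
      (comparisonLaw (plantedMatrix S false)).prod (comparisonLaw (plantedMatrix S true)) := by
  classical
  let K := Bool × Fin (n / 2) × Fin (n / 2)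
  -- One coin per potential edge, plus dummy coins indexed by `K`. The entries with `j ≤ i` use
  -- dummies, which `φ` ignores; so every entry reads its own coin through the injection `ε`, and
  -- independence follows.
  let ν : Sym2 (Fin n) ⊕ K → Measure Prop := fun e =>
    unitInterval.toNNReal oneHalf • Measure.dirac (Sum.elim (fun e => ¬ e.IsDiag) (fun _ => True) e) +
      unitInterval.toNNReal (unitInterval.symm oneHalf) • Measure.dirac False
  have hν : ∀ e, IsProbabilityMeasure (ν e) := fun e =>
    inferInstanceAs (IsProbabilityMeasure (bernoulliMeasure _ _ _))
  let ε : K → Sym2 (Fin n) ⊕ K := fun k =>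
    if k.2.1 < k.2.2 then Sum.inl (sampleEdge k) else Sum.inr k
  have hε : Function.Injective ε := by
    intro k k' h
    simp only [ε] at h
    split_ifs at h with h1 h2
    · exact sampleEdge_injOn h1 h2 (Sum.inl_injective h)
    · exact Sum.inr_injective h
  let φ : K → Prop → Bool := fun k q => decide (k.2.1 < k.2.2 ∧
    (q ∨ plantedItems S k.1 k.2.1 ∧ plantedItems S (!k.1) k.2.2))
  let ρ : K → Measure Bool := fun k =>
    bernoulliMeasure true false (if k.2.1 < k.2.2 then plantedMatrix S k.1 k.2.1 k.2.2 else 0)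
  have hρ : ∀ k, (ν (ε k)).map (φ k) = ρ k := by
    rintro ⟨b, i, j⟩
    simp only [ν, ρ, φ, ε, plantedMatrix, stairMatrix]
    rw [Measure.map_add _ _ .of_discrete, Measure.map_smul, Measure.map_smul,
      Measure.map_dirac' .of_discrete, Measure.map_dirac' .of_discrete]
    by_cases hij : i < j
    · have hd : ¬ (sampleEdge (b, i, j) : Sym2 (Fin n)).IsDiag := by
        simp only [sampleEdge, Sym2.mk_isDiag_iff]
        intro h; have := (itemVertex_injective h).1; cases b <;> simp at this
      by_cases hp : plantedItems S b i ∧ plantedItems S (!b) j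
      · simp [hij, hp, ← bernoulliMeasure_def]
      · simp [hij, hp, hd, not_lt.2 hij.le, ← bernoulliMeasure_def]
    · simp [hij, ← bernoulliMeasure_def]
  have hρ' : ∀ k, IsProbabilityMeasure (ρ k) := fun k =>
    inferInstanceAs (IsProbabilityMeasure (bernoulliMeasure _ _ _))
  have hlaw : (Measure.infinitePi ν).map (fun x k => φ k (x (ε k))) = Measure.pi ρ := by
    have := Measure.map_infinitePi_infinitePi_of_inj (P := ν) hε
    have h2 := Measure.infinitePi_map_pi (μ := fun k => ν (ε k)) (f := φ)
      (fun k => .of_discrete)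
    rw [← this, Measure.map_map .of_discrete .of_discrete] at h2
    simp only [hρ, Measure.infinitePi_eq_pi (μ := ρ)] at h2
    exact h2
  have hsrc := Measure.map_infinitePi_infinitePi_of_inj (P := ν) (Sum.inl_injective (β := K))
  have hleft : (SimpleGraph.binomialRandom (Fin n) oneHalf).map (fun G =>
      ((fun i j : Fin (n / 2) => graphSample (plantClique G S) false i j),
        (fun i j : Fin (n / 2) => graphSample (plantClique G S) true i j))) =
      (Measure.pi ρ).map (fun z => ((fun i j => z (false, i, j)), fun i j => z (true, i, j))) := by
    rw [← hlaw, SimpleGraph.binomialRandom_eq_map_infinitePi]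
    change Measure.map _ (Measure.map _ (Measure.infinitePi fun i => ν (Sum.inl i))) = _
    rw [← hsrc, Measure.map_map .of_discrete .of_discrete, Measure.map_map .of_discrete .of_discrete,
      Measure.map_map .of_discrete .of_discrete]
    congr 1
    funext x
    have hgen : ∀ (b : Bool) (i j : Fin (n / 2)),
        graphSample (plantClique (SimpleGraph.fromEdgeSet {e | x (Sum.inl e)}) S) b i j =
          φ (b, i, j) (x (ε (b, i, j))) := by
      intro b i j
      have hd : ¬ (sampleEdge (b, i, j) : Sym2 (Fin n)).IsDiag := by
        simp only [sampleEdge, Sym2.mk_isDiag_iff]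
        intro h; have := (itemVertex_injective h).1; cases b <;> simp at this
      rw [graphSample_plantClique]
      simp only [φ, ε]
      by_cases hij : i < j
      · simp [hij, hd]
      · simp [hij]
    simp only [Function.comp_def, hgen]
  rw [hleft]
  refine Measure.ext_of_singleton fun ⟨x, y⟩ => ?_
  rw [Measure.map_apply .of_discrete .of_discrete]
  have hpre : (fun z : K → Bool => ((fun i j => z (false, i, j)), fun i j => z (true, i, j))) ⁻¹'
      {(x, y)} = {fun k : K => if k.1 then y k.2.1 k.2.2 else x k.2.1 k.2.2} := by
    ext z
    simp only [Set.mem_preimage, Set.mem_singleton_iff, Prod.mk.injEq, funext_iff]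
    simp [K]
  rw [hpre, Measure.pi_singleton, ← Set.singleton_prod_singleton, Measure.prod_prod]
  simp only [comparisonLaw, Measure.pi_singleton]
  rw [Fintype.prod_prod_type, Fintype.prod_bool]
  simp only [Fintype.prod_prod_type, ρ]
  simp [mul_comm]

end law

/-! ### Uniformly random subsets -/

section subsets

open Finset

variable {V : Type*} [Fintype V] [DecidableEq V]

theorem card_powersetCard_filter_mem (k : ℕ) (v : V) :
    (#{S ∈ (univ : Finset V).powersetCard k | v ∈ S} : ℝ) * Fintype.card V =
      (Fintype.card V).choose k * k := by
  have he : ({S ∈ (univ : Finset V).powersetCard k | v ∈ S} : Finset (Finset V)) =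
      {S ∈ (univ : Finset V).powersetCard k | {v} ⊆ S} := by simp
  rcases Nat.eq_zero_or_pos k with rfl | hk
  · simp
  · rw [he, card_filter_powersetCard_subset _ _ _ (subset_univ _) (by rwa [card_singleton])]
    have := Nat.choose_mul (n := Fintype.card V) (k := k) (s := 1) hk
    simp only [Nat.choose_one_right] at this
    simp only [card_univ, card_singleton]
    rw [mul_comm]
    exact_mod_cast this.symm

theorem card_powersetCard_filter_mem_mem (k : ℕ) {u v : V} (huv : u ≠ v) :
    (#{S ∈ (univ : Finset V).powersetCard k | u ∈ S ∧ v ∈ S} : ℝ) *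
      (Fintype.card V * (Fintype.card V - 1)) = (Fintype.card V).choose k * (k * (k - 1)) := by
  have he : ({S ∈ (univ : Finset V).powersetCard k | u ∈ S ∧ v ∈ S} : Finset (Finset V)) =
      {S ∈ (univ : Finset V).powersetCard k | {u, v} ⊆ S} := by simp [insert_subset_iff]
  rcases Nat.lt_or_ge k 2 with hk | hk
  · have h0 : ({S ∈ (univ : Finset V).powersetCard k | {u, v} ⊆ S} : Finset (Finset V)) = ∅ := by
      refine filter_eq_empty_iff.2 fun S hS h => ?_
      have := card_le_card h
      rw [card_pair huv, (mem_powersetCard.1 hS).2] at this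
      omega
    rw [he, h0]
    interval_cases k <;> simp
  · rw [he, card_filter_powersetCard_subset _ _ _ (subset_univ _) (by rwa [card_pair huv])]
    have := Nat.choose_mul (n := Fintype.card V) (k := k) (s := 2) hk
    simp only [card_univ, card_pair huv]
    have h : ((Fintype.card V).choose k : ℝ) * (k.choose 2 : ℕ) =
        ((Fintype.card V).choose 2 : ℕ) * ((Fintype.card V - 2).choose (k - 2) : ℕ) := by
      exact_mod_cast this
    rw [Nat.cast_choose_two, Nat.cast_choose_two] at h
    linarith

theorem pair_fraction_le {n k : ℝ} (hk : 0 ≤ k) (hkn : k ≤ n) (hn : 1 < n) :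
    k * (k - 1) / (n * (n - 1)) ≤ (k / n) ^ 2 := by
  rw [div_pow, div_le_div_iff₀ (by nlinarith) (by positivity)]
  nlinarith [mul_nonneg (mul_nonneg hk (by linarith : (0 : ℝ) ≤ n)) (sub_nonneg.2 hkn)]

/-- Memberships of distinct points in a uniform `k`-subset are negatively correlated
(`pair_fraction_le`), so the variance of `#(S ∩ W)` is at most its mean. -/
theorem sum_sq_card_inter_sub_le (k : ℕ) (hk : k ≤ Fintype.card V) (hV : 1 < Fintype.card V)
    (W : Finset V) :
    ∑ S ∈ (univ : Finset V).powersetCard k, ((#(S ∩ W) : ℝ) - k * #W / Fintype.card V) ^ 2 ≤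
      (Fintype.card V).choose k * (k * #W / Fintype.card V) := by
  set C : ℝ := ((Fintype.card V).choose k : ℝ) with hC
  set n : ℝ := (Fintype.card V : ℝ) with hn
  have hn1 : 1 < n := by rw [hn]; exact_mod_cast hV
  have hkn : (k : ℝ) ≤ n := by rw [hn]; exact_mod_cast hk
  have hC0 : 0 ≤ C := by positivity
  have hw : (0 : ℝ) ≤ #W := by positivity
  have hcard : ∀ S : Finset V, (#(S ∩ W) : ℝ) = ∑ v ∈ W, if v ∈ S then 1 else 0 := by
    intro S
    rw [inter_comm, ← filter_mem_eq_inter, card_filter]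
    push_cast
    rfl
  have h1 : ∑ S ∈ (univ : Finset V).powersetCard k, (#(S ∩ W) : ℝ) = C * (k * #W / n) := by
    simp_rw [hcard]
    rw [sum_comm]
    have : ∀ v ∈ W, ∑ S ∈ (univ : Finset V).powersetCard k, (if v ∈ S then (1 : ℝ) else 0) =
        C * k / n := by
      intro v _
      rw [eq_div_iff (by positivity), ← card_powersetCard_filter_mem k v, card_filter]
      push_cast
      rfl
    rw [sum_congr rfl this, sum_const, nsmul_eq_mul]
    ring
  have h2 : ∑ S ∈ (univ : Finset V).powersetCard k, (#(S ∩ W) : ℝ) ^ 2 ≤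
      C * (k * #W / n + (k * #W / n) ^ 2) := by
    have hsq : ∀ S : Finset V, (#(S ∩ W) : ℝ) ^ 2 =
        ∑ u ∈ W, ∑ v ∈ W, if u ∈ S ∧ v ∈ S then 1 else 0 := by
      intro S
      rw [hcard, sq, sum_mul_sum]
      refine sum_congr rfl fun u _ => sum_congr rfl fun v _ => ?_
      by_cases h : u ∈ S <;> by_cases h' : v ∈ S <;> simp [h, h']
    simp_rw [hsq]
    rw [sum_comm]
    have hu : ∀ u ∈ W, ∑ S ∈ (univ : Finset V).powersetCard k,
        ∑ v ∈ W, (if u ∈ S ∧ v ∈ S then (1 : ℝ) else 0) ≤ C * (k / n + #W * (k / n) ^ 2) := by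
      intro u hu
      rw [sum_comm, ← add_sum_erase _ _ hu]
      have hfirst : ∑ S ∈ (univ : Finset V).powersetCard k,
          (if u ∈ S ∧ u ∈ S then (1 : ℝ) else 0) = C * (k / n) := by
        rw [← mul_div_assoc, eq_div_iff (by positivity), ← card_powersetCard_filter_mem k u,
          card_filter]
        push_cast
        simp only [and_self]
        rfl
      have hrest : ∀ v ∈ W.erase u, ∑ S ∈ (univ : Finset V).powersetCard k,
          (if u ∈ S ∧ v ∈ S then (1 : ℝ) else 0) ≤ C * (k / n) ^ 2 := by
        intro v hv
        have hne : u ≠ v := (ne_of_mem_erase hv).symm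
        have : ∑ S ∈ (univ : Finset V).powersetCard k,
            (if u ∈ S ∧ v ∈ S then (1 : ℝ) else 0) = C * (k * (k - 1) / (n * (n - 1))) := by
          rw [← mul_div_assoc, eq_div_iff (by nlinarith),
            ← card_powersetCard_filter_mem_mem k hne, card_filter]
          push_cast
          rfl
        rw [this]
        exact mul_le_mul_of_nonneg_left (pair_fraction_le (by positivity) hkn hn1) hC0
      have hsum := sum_le_card_nsmul _ _ _ hrest
      have hle : (#(W.erase u) : ℝ) ≤ #W := by exact_mod_cast card_le_card (erase_subset _ _)
      rw [nsmul_eq_mul] at hsum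
      have := mul_le_mul_of_nonneg_right hle (by positivity : 0 ≤ C * (k / n) ^ 2)
      rw [hfirst]
      linarith
    refine (sum_le_card_nsmul _ _ _ hu).trans (le_of_eq ?_)
    rw [nsmul_eq_mul]
    ring
  have h3 : ∑ S ∈ (univ : Finset V).powersetCard k, (1 : ℝ) = C := by simp [hC]
  have hexp : ∑ S ∈ (univ : Finset V).powersetCard k, ((#(S ∩ W) : ℝ) - k * #W / n) ^ 2 =
      ∑ S ∈ (univ : Finset V).powersetCard k, (#(S ∩ W) : ℝ) ^ 2 -
        2 * (k * #W / n) * ∑ S ∈ (univ : Finset V).powersetCard k, (#(S ∩ W) : ℝ) +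
        (k * #W / n) ^ 2 * ∑ S ∈ (univ : Finset V).powersetCard k, (1 : ℝ) := by
    rw [mul_sum, mul_sum, ← sum_sub_distrib, ← sum_add_distrib]
    refine sum_congr rfl fun S _ => ?_
    ring
  rw [hexp, h1, h3]
  nlinarith

/-- Chebyshev's inequality with variance at most `μ` and deviation `μ / 2`. -/
theorem card_filter_card_inter_lt_le (k : ℕ) (hk : k ≤ Fintype.card V) (hV : 1 < Fintype.card V)
    (W : Finset V) {μ : ℝ} (hμ : μ = k * #W / Fintype.card V) (hμ0 : 0 < μ) :
    (#{S ∈ (univ : Finset V).powersetCard k | (#(S ∩ W) : ℝ) < μ / 2} : ℝ) ≤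
      (Fintype.card V).choose k * (4 / μ) := by
  have h := sum_sq_card_inter_sub_le k hk hV W
  rw [← hμ] at h
  have h2 : (#{S ∈ (univ : Finset V).powersetCard k | (#(S ∩ W) : ℝ) < μ / 2} : ℝ) * (μ / 2) ^ 2 ≤
      ∑ S ∈ (univ : Finset V).powersetCard k, ((#(S ∩ W) : ℝ) - μ) ^ 2 := by
    rw [← nsmul_eq_mul]
    refine (card_nsmul_le_sum _ _ _ fun S hS => ?_).trans
      (sum_le_sum_of_subset_of_nonneg (filter_subset _ _) fun _ _ _ => sq_nonneg _)
    have := (mem_filter.1 hS).2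
    nlinarith
  have h3 := h2.trans h
  rw [← mul_div_assoc, le_div_iff₀ hμ0]
  nlinarith

theorem card_filter_exists_mem_mem_le {ι : Type*} [Fintype ι] (k : ℕ) (hk : k ≤ Fintype.card V)
    (hV : 1 < Fintype.card V) (f g : ι → V) (hfg : ∀ i, f i ≠ g i) :
    (#{S ∈ (univ : Finset V).powersetCard k | ∃ i, f i ∈ S ∧ g i ∈ S} : ℝ) ≤
      (Fintype.card V).choose k * (Fintype.card ι * (k / Fintype.card V) ^ 2) := by
  classical
  have hsub : ({S ∈ (univ : Finset V).powersetCard k | ∃ i, f i ∈ S ∧ g i ∈ S} :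
      Finset (Finset V)) ⊆ (univ : Finset ι).biUnion fun i =>
        {S ∈ (univ : Finset V).powersetCard k | f i ∈ S ∧ g i ∈ S} := by
    intro S hS
    obtain ⟨hS, i, hi⟩ := mem_filter.1 hS
    exact mem_biUnion.2 ⟨i, mem_univ _, mem_filter.2 ⟨hS, hi⟩⟩
  have h1 : (#{S ∈ (univ : Finset V).powersetCard k | ∃ i, f i ∈ S ∧ g i ∈ S} : ℝ) ≤
      ∑ i : ι, (#{S ∈ (univ : Finset V).powersetCard k | f i ∈ S ∧ g i ∈ S} : ℝ) := by
    exact_mod_cast (card_le_card hsub).trans card_biUnion_le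
  refine h1.trans ?_
  have hV' : (1 : ℝ) < Fintype.card V := by exact_mod_cast hV
  have h2 : ∀ i ∈ (univ : Finset ι),
      (#{S ∈ (univ : Finset V).powersetCard k | f i ∈ S ∧ g i ∈ S} : ℝ) ≤
        (Fintype.card V).choose k * (k / Fintype.card V) ^ 2 := by
    intro i _
    have := card_powersetCard_filter_mem_mem k (hfg i)
    rw [← eq_div_iff (by nlinarith), mul_div_assoc] at this
    rw [this]
    exact mul_le_mul_of_nonneg_left
      (pair_fraction_le (by positivity) (by exact_mod_cast hk) hV') (by positivity)
  refine (sum_le_card_nsmul _ _ _ h2).trans (le_of_eq ?_)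
  rw [nsmul_eq_mul, card_univ]
  ring

end subsets

/-! ### The distance between the two planted matrices -/

section distance

open Finset

variable {n : ℕ}

/-- The vertices of type `false` owned by the first half of the items. -/
def headVertices (n : ℕ) : Finset (Fin n) :=
  ({i : Fin (n / 2) | (i : ℕ) < n / 2 / 2} : Finset _).image (itemVertex false)

/-- The vertices of type `true` owned by the second half of the items. -/
def tailVertices (n : ℕ) : Finset (Fin n) :=
  ({i : Fin (n / 2) | n / 2 / 2 ≤ (i : ℕ)} : Finset _).image (itemVertex true)

theorem itemVertex_inj (b : Bool) : Function.Injective (itemVertex (n := n) b) :=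
  fun _ _ h => (itemVertex_injective h).2

theorem itemVertex_false_ne_true (i j : Fin (n / 2)) :
    itemVertex (n := n) false i ≠ itemVertex true j :=
  fun h => by simpa using (itemVertex_injective h).1

theorem card_filter_val_lt (d h : ℕ) (hh : h ≤ d) : #{i : Fin d | (i : ℕ) < h} = h := by
  rw [Fin.card_filter_val_lt]
  omega

theorem card_headVertices : #(headVertices n) = n / 2 / 2 := by
  rw [headVertices, card_image_of_injective _ (itemVertex_inj _), card_filter_val_lt]
  omega

theorem card_tailVertices : n / 2 / 2 ≤ #(tailVertices n) := by
  rw [tailVertices, card_image_of_injective _ (itemVertex_inj _)]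
  have h := card_filter_add_card_filter_not (s := (univ : Finset (Fin (n / 2))))
    (fun i => (i : ℕ) < n / 2 / 2)
  rw [card_filter_val_lt _ _ (by omega), card_univ, Fintype.card_fin] at h
  simp only [not_lt] at h
  omega

theorem sum_sq_plantedMatrix_ge (S : Finset (Fin n))
    (hS : ∀ i, ¬(plantedItems S false i ∧ plantedItems S true i)) :
    (#(S ∩ headVertices n) * #(S ∩ tailVertices n) : ℝ) / 4 ≤
      ∑ i, ∑ j, ((plantedMatrix S false i j : ℝ) - (plantedMatrix S true i j : ℝ)) ^ 2 := by
  classical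
  have himage : ∀ (b : Bool) (H : Finset (Fin (n / 2))),
      #(S ∩ H.image (itemVertex b)) = #{i ∈ H | plantedItems S b i} := by
    intro b H
    rw [← card_image_of_injective _ (itemVertex_inj b)]
    congr 1
    ext v
    simp only [mem_inter, mem_image, mem_filter]
    constructor
    · rintro ⟨hv, i, hi, rfl⟩; exact ⟨i, ⟨hi, hv⟩, rfl⟩
    · rintro ⟨i, ⟨hi, hv⟩, rfl⟩; exact ⟨hv, i, hi, rfl⟩
  rw [headVertices, tailVertices, himage, himage]
  set H := ({i ∈ ({i : Fin (n / 2) | (i : ℕ) < n / 2 / 2} : Finset _) | plantedItems S false i} :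
    Finset _)
  set T := ({i ∈ ({i : Fin (n / 2) | n / 2 / 2 ≤ (i : ℕ)} : Finset _) | plantedItems S true i} :
    Finset _)
  have hval : ∀ i ∈ H, ∀ j ∈ T, (1 : ℝ) / 4 ≤
      ((plantedMatrix S false i j : ℝ) - (plantedMatrix S true i j : ℝ)) ^ 2 := by
    intro i hi j hj
    simp only [H, T, mem_filter, mem_univ, true_and] at hi hj
    -- Splitting the items into halves makes the order automatic.
    have hij : i < j := Fin.lt_def.2 (by omega)
    have h1 : plantedMatrix S false i j = 1 := by
      simp only [plantedMatrix, stairMatrix]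
      rw [if_pos ⟨hij, hi.2, hj.2⟩]
    have h2 : plantedMatrix S true i j = oneHalf := by
      simp only [plantedMatrix, stairMatrix]
      rw [if_neg fun h => hS i ⟨hi.2, h.2.1⟩, if_neg fun h => absurd h.1 (not_lt.2 hij.le)]
    rw [h1, h2, oneHalf_coe]
    norm_num
  calc (#H * #T : ℝ) / 4 = ∑ i ∈ H, ∑ j ∈ T, (1 : ℝ) / 4 := by simp; ring
    _ ≤ ∑ i ∈ H, ∑ j ∈ T,
        ((plantedMatrix S false i j : ℝ) - (plantedMatrix S true i j : ℝ)) ^ 2 :=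
      sum_le_sum fun i hi => sum_le_sum fun j hj => hval i hi j hj
    _ ≤ ∑ i ∈ H, ∑ j,
        ((plantedMatrix S false i j : ℝ) - (plantedMatrix S true i j : ℝ)) ^ 2 :=
      sum_le_sum fun i _ => sum_le_sum_of_subset_of_nonneg (subset_univ _)
        fun _ _ _ => sq_nonneg _
    _ ≤ _ := sum_le_sum_of_subset_of_nonneg (subset_univ _)
        fun _ _ _ => sum_nonneg fun _ _ => sq_nonneg _

end distance

/-! ### From a test to an algorithm for the planted clique problem -/

/-- The graph algorithm that applies a test to the comparison data extracted from the graph. -/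
noncomputable def PolyTimeTest.toGraphAlgorithm (φ : PolyTimeTest) : PolyTimeGraphAlgorithm where
  run n G := φ.test (n / 2) (fun i j => graphSample G false i j) (fun i j => graphSample G true i j)
  polyTime := IsPolyTime.comp_graphData φ.polyTime

theorem PolyTimeTest.real_run_plantClique (φ : PolyTimeTest) {n : ℕ} (S : Finset (Fin n))
    (b : Bool) :
    (SimpleGraph.binomialRandom (Fin n) oneHalf).real
      {G | φ.toGraphAlgorithm.run n (plantClique G S) = b} =
      (answerProb (φ.test (n / 2)) (plantedMatrix S false) (plantedMatrix S true) b).toReal := by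
  rw [answerProb, ← map_graphSample, Measure.map_apply .of_discrete .of_discrete]
  rfl

theorem answerProb_true_le_sstRisk {d : ℕ}
    (φ : (Fin d → Fin d → Bool) → (Fin d → Fin d → Bool) → Bool) (ε : ℝ)
    {P : Matrix (Fin d) (Fin d) unitInterval} (hP : IsSST P) :
    answerProb φ P P true ≤ sstRisk φ ε :=
  (le_iSup₂ (f := fun P (_ : IsSST P) => answerProb φ P P true) P hP).trans le_self_add

theorem answerProb_false_le_sstRisk {d : ℕ}
    (φ : (Fin d → Fin d → Bool) → (Fin d → Fin d → Bool) → Bool) {ε : ℝ}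
    {P Q : Matrix (Fin d) (Fin d) unitInterval} (hP : IsSST P) (hQ : IsSST Q)
    (hε : ε ≤ frobeniusDist P Q) :
    answerProb φ P Q false ≤ sstRisk φ ε := by
  refine le_trans ?_ le_add_self
  exact le_iSup_of_le P (le_iSup_of_le Q (le_iSup_of_le hP (le_iSup_of_le hQ
    (le_iSup_of_le hε le_rfl))))

theorem toReal_le_third {x : ℝ≥0∞} (h : x ≤ 1 / 3) : x.toReal ≤ 1 / 3 := by
  have := ENNReal.toReal_mono (by norm_num) h
  simpa using this

theorem plantClique_empty {n : ℕ} (G : SimpleGraph (Fin n)) : plantClique G ∅ = G := by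
  ext u v
  simp [plantClique]

theorem plantedMatrix_empty {n : ℕ} (b : Bool) :
    plantedMatrix (∅ : Finset (Fin n)) b = fun _ _ => oneHalf := by
  funext i j
  simp [plantedMatrix, stairMatrix, plantedItems]

theorem isSST_plantedMatrix {n : ℕ} {S : Finset (Fin n)}
    (hS : ∀ i, ¬(plantedItems S false i ∧ plantedItems S true i)) (b : Bool) :
    IsSST (plantedMatrix S b) := by
  refine isSST_stairMatrix fun i h => hS i ?_
  cases b
  · exact h
  · exact h.symm

theorem PolyTimeTest.errorNull_le (φ : PolyTimeTest) {n : ℕ} {ε : ℝ}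
    (hφ : sstRisk (φ.test (n / 2)) ε ≤ 1 / 3) : φ.toGraphAlgorithm.errorNull n ≤ 1 / 3 := by
  have h := φ.real_run_plantClique (∅ : Finset (Fin n)) true
  simp only [plantClique_empty] at h
  rw [PolyTimeGraphAlgorithm.errorNull, h]
  refine toReal_le_third (le_trans ?_ hφ)
  have hSST := isSST_plantedMatrix (S := (∅ : Finset (Fin n))) (by simp [plantedItems]) false
  have he : plantedMatrix (∅ : Finset (Fin n)) true = plantedMatrix ∅ false := by
    rw [plantedMatrix_empty, plantedMatrix_empty]
  rw [he]
  exact answerProb_true_le_sstRisk _ _ hSST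

open Finset in
theorem PolyTimeTest.errorPlanted_le (φ : PolyTimeTest) {n k : ℕ} {ε : ℝ} (hn : 8 ≤ n)
    (hk : 0 < k) (hkn : k ≤ n) (hε : ε ≤ 1 / ((n / 2 : ℕ) : ℝ) * (k / 32))
    (hφ : sstRisk (φ.test (n / 2)) ε ≤ 1 / 3) :
    φ.toGraphAlgorithm.errorPlanted n k ≤ 1 / 3 + (k ^ 2 / n + 64 / k) := by
  classical
  have hk0 : (0 : ℝ) < k := by exact_mod_cast hk
  have hn0 : (0 : ℝ) < n := by exact_mod_cast (by omega : 0 < n)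
  have hC : (0 : ℝ) < n.choose k := by exact_mod_cast Nat.choose_pos hkn
  have hcn : Fintype.card (Fin n) = n := Fintype.card_fin n
  -- Since `n ≤ 8 * (n / 2 / 2)` here, the mean intersection is at least `k / 8`; half of it is the
  -- threshold `k / 16`.
  have hmean : ∀ W : Finset (Fin n), n / 2 / 2 ≤ #W → (k : ℝ) / 8 ≤ k * #W / n := by
    intro W hW
    have h1 : n ≤ 8 * #W := by omega
    have h2 : (n : ℝ) ≤ 8 * #W := by exact_mod_cast h1
    rw [div_le_div_iff₀ (by norm_num) hn0]
    nlinarith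
  have hsmall : ∀ W : Finset (Fin n), n / 2 / 2 ≤ #W →
      (#{S ∈ (univ : Finset (Fin n)).powersetCard k | (#(S ∩ W) : ℝ) < k / 16} : ℝ) ≤
        n.choose k * (32 / k) := by
    intro W hW
    have hμ := hmean W hW
    have h := card_filter_card_inter_lt_le k (by rwa [hcn]) (by rw [hcn]; omega) W rfl
      (by rw [hcn]; linarith)
    rw [hcn] at h
    have hsub : (#{S ∈ (univ : Finset (Fin n)).powersetCard k | (#(S ∩ W) : ℝ) < k / 16} : ℝ) ≤
        #{S ∈ (univ : Finset (Fin n)).powersetCard k | (#(S ∩ W) : ℝ) < k * #W / n / 2} := by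
      refine Nat.cast_le.2 (card_le_card fun S hS => ?_)
      rw [mem_filter] at hS ⊢
      exact ⟨hS.1, by linarith [hS.2]⟩
    refine (hsub.trans h).trans (mul_le_mul_of_nonneg_left ?_ hC.le)
    rw [div_le_div_iff₀ (by linarith) hk0]
    linarith
  have hdouble := card_filter_exists_mem_mem_le k (by rwa [hcn]) (by rw [hcn]; omega)
    (itemVertex (n := n) false) (itemVertex true) fun i => itemVertex_false_ne_true i i
  rw [hcn, Fintype.card_fin] at hdouble
  have hdouble' : (n.choose k : ℝ) * ((n / 2 : ℕ) * (k / n : ℝ) ^ 2) ≤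
      n.choose k * (k ^ 2 / n) := by
    refine mul_le_mul_of_nonneg_left ?_ hC.le
    have : ((n / 2 : ℕ) : ℝ) ≤ n := by exact_mod_cast Nat.div_le_self n 2
    calc ((n / 2 : ℕ) : ℝ) * ((k : ℝ) / n) ^ 2 ≤ (n : ℝ) * ((k : ℝ) / n) ^ 2 := by gcongr
      _ = (k : ℝ) ^ 2 / n := by field_simp
  have hhead := hsmall (headVertices n) card_headVertices.ge
  have htail := hsmall (tailVertices n) card_tailVertices
  have hbound : ∀ S ∈ (univ : Finset (Fin n)).powersetCard k,
      (SimpleGraph.binomialRandom (Fin n) oneHalf).real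
        {G | φ.toGraphAlgorithm.run n (plantClique G S) = false} ≤
      1 / 3 + ((if ∃ i, itemVertex false i ∈ S ∧ itemVertex true i ∈ S then 1 else 0) +
        (if (#(S ∩ headVertices n) : ℝ) < k / 16 then 1 else 0) +
        (if (#(S ∩ tailVertices n) : ℝ) < k / 16 then 1 else 0)) := by
    intro S _
    have hle1 : (SimpleGraph.binomialRandom (Fin n) oneHalf).real
        {G | φ.toGraphAlgorithm.run n (plantClique G S) = false} ≤ 1 := measureReal_le_one
    by_cases h1 : ∃ i, itemVertex (n := n) false i ∈ S ∧ itemVertex true i ∈ S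
    · rw [if_pos h1]; split_ifs <;> linarith
    by_cases h2 : (#(S ∩ headVertices n) : ℝ) < k / 16
    · rw [if_neg h1, if_pos h2]; split_ifs <;> linarith
    by_cases h3 : (#(S ∩ tailVertices n) : ℝ) < k / 16
    · rw [if_neg h1, if_neg h2, if_pos h3]; linarith
    rw [if_neg h1, if_neg h2, if_neg h3, φ.real_run_plantClique]
    push Not at h2 h3
    have hS : ∀ i, ¬(plantedItems S false i ∧ plantedItems S true i) := fun i hi => h1 ⟨i, hi⟩
    -- `(k / 16)² / 4 = (k / 32)²`.
    have hdist : ε ≤ frobeniusDist (plantedMatrix S false) (plantedMatrix S true) := by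
      refine hε.trans (mul_le_mul_of_nonneg_left (Real.le_sqrt_of_sq_le ?_) (by positivity))
      refine le_trans ?_ (sum_sq_plantedMatrix_ge S hS)
      have := mul_le_mul h2 h3 (by positivity) (by positivity)
      nlinarith
    have := toReal_le_third ((answerProb_false_le_sstRisk (φ.test (n / 2))
      (isSST_plantedMatrix hS false) (isSST_plantedMatrix hS true) hdist).trans hφ)
    linarith
  rw [PolyTimeGraphAlgorithm.errorPlanted, div_le_iff₀ hC]
  refine (sum_le_sum hbound).trans ?_
  rw [sum_add_distrib, sum_add_distrib, sum_add_distrib, sum_boole, sum_boole, sum_boole, sum_const,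
    card_powersetCard, card_univ, hcn, nsmul_eq_mul]
  have h64 : (64 : ℝ) / k = 32 / k + 32 / k := by ring
  have hd : (#{S ∈ (univ : Finset (Fin n)).powersetCard k |
      ∃ i, itemVertex false i ∈ S ∧ itemVertex true i ∈ S} : ℝ) ≤ n.choose k * (k ^ 2 / n) := by
    refine le_trans (le_of_eq ?_) (hdouble.trans hdouble')
    congr!
  rw [h64]
  linarith

/-! ### Asymptotics -/

/-- The clique size `⌊√n / log log n⌋`, capped at `n`. -/
noncomputable def cliqueSize (n : ℕ) : ℕ :=
  min n ⌊Real.sqrt n / Real.log (Real.log n)⌋₊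

theorem tendsto_log_log_nat :
    Tendsto (fun n : ℕ => Real.log (Real.log n)) atTop atTop :=
  Real.tendsto_log_atTop.comp (Real.tendsto_log_atTop.comp tendsto_natCast_atTop_atTop)

theorem tendsto_sqrt_div_log_log :
    Tendsto (fun n : ℕ => Real.sqrt n / Real.log (Real.log n)) atTop atTop := by
  have h1 : Tendsto (fun x : ℝ => Real.log x / x ^ (1 / 2 : ℝ)) atTop (nhds 0) :=
    (isLittleO_log_rpow_atTop (by norm_num)).tendsto_div_nhds_zero
  have h2 : Tendsto (fun x : ℝ => (Real.log x / x ^ (1 / 2 : ℝ))⁻¹) atTop atTop := by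
    refine tendsto_inv_nhdsGT_zero.comp (tendsto_nhdsWithin_iff.2 ⟨h1, ?_⟩)
    filter_upwards [eventually_gt_atTop 1] with x hx
    exact div_pos (Real.log_pos hx) (by positivity)
  refine tendsto_atTop_mono' _ ?_ (h2.comp tendsto_natCast_atTop_atTop)
  filter_upwards [tendsto_log_log_nat.eventually_gt_atTop 0,
    (Real.tendsto_log_atTop.comp tendsto_natCast_atTop_atTop).eventually_gt_atTop 0] with n hn hn'
  simp only [Function.comp_apply] at hn' ⊢
  rw [inv_div, ← Real.sqrt_eq_rpow]
  exact div_le_div_of_nonneg_left (Real.sqrt_nonneg _) hn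
    ((Real.log_le_sub_one_of_pos hn').trans (by linarith))

theorem cliqueSize_le (n : ℕ) : cliqueSize n ≤ n := min_le_left _ _

theorem eventually_cliqueSize_le :
    ∀ᶠ n : ℕ in atTop, (cliqueSize n : ℝ) ≤ Real.sqrt n / Real.log (Real.log n) := by
  filter_upwards [tendsto_log_log_nat.eventually_gt_atTop 0] with n hn
  exact (Nat.cast_le.2 (min_le_right _ _)).trans (Nat.floor_le (by positivity))

theorem eventually_le_cliqueSize :
    ∀ᶠ n : ℕ in atTop, Real.sqrt n / Real.log (Real.log n) / 2 ≤ cliqueSize n := by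
  filter_upwards [tendsto_log_log_nat.eventually_ge_atTop 1,
    tendsto_sqrt_div_log_log.eventually_ge_atTop 2, eventually_ge_atTop 1] with n hn hn2 hn1
  rw [cliqueSize, Nat.cast_min, le_min_iff]
  have hn1' : (1 : ℝ) ≤ n := by exact_mod_cast hn1
  constructor
  · have h1 : Real.sqrt n / Real.log (Real.log n) ≤ Real.sqrt n :=
      div_le_self (Real.sqrt_nonneg _) hn
    have h2 : Real.sqrt n ≤ n := Real.sqrt_le_iff.2 ⟨by positivity, by nlinarith⟩
    linarith
  · have := Nat.lt_floor_add_one (Real.sqrt n / Real.log (Real.log n))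
    linarith

theorem tendsto_cliqueSize : Tendsto (fun n => (cliqueSize n : ℝ)) atTop atTop :=
  tendsto_atTop_mono' _ eventually_le_cliqueSize
    (tendsto_sqrt_div_log_log.atTop_div_const (by norm_num))

theorem cliqueSize_isLittleO :
    (fun n => (cliqueSize n : ℝ)) =o[atTop] (fun n : ℕ => Real.sqrt n) := by
  have h1 : (fun n : ℕ => Real.sqrt n / Real.log (Real.log n)) =o[atTop]
      fun n : ℕ => Real.sqrt n := by
    have h := (isLittleO_const_left (c := (1 : ℝ)) (g'' := fun n : ℕ => Real.log (Real.log n))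
      (l := atTop)).2 (Or.inr (tendsto_norm_atTop_atTop.comp tendsto_log_log_nat))
    refine IsLittleO.of_bound fun c hc => ?_
    filter_upwards [h.bound hc, tendsto_log_log_nat.eventually_gt_atTop 0] with n hn hn0
    rw [norm_div, div_le_iff₀ (norm_pos_iff.2 hn0.ne')]
    rw [norm_one] at hn
    nlinarith [norm_nonneg (Real.sqrt n)]
  refine IsBigO.trans_isLittleO (IsBigO.of_bound 1 ?_) h1
  filter_upwards [eventually_cliqueSize_le] with n hn
  rw [one_mul, Real.norm_of_nonneg (by positivity)]
  exact hn.trans (le_abs_self _)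

theorem tendsto_half : Tendsto (fun n : ℕ => n / 2) atTop atTop :=
  Nat.tendsto_div_const_atTop (by norm_num)

/-- The infimum need not be attained; the factor `2` makes the inequality strict and yields an
admissible `ε`. -/
theorem PolyTimeTest.exists_radius (φ : PolyTimeTest) {d : ℕ} {x : ℝ} (hx : 0 < x)
    (h : φ.criticalRadius d ^ 2 ≤ ENNReal.ofReal x) :
    ∃ ε, ε ≤ Real.sqrt (2 * x) ∧ sstRisk (φ.test d) ε ≤ 1 / 3 := by
  have hlt : φ.criticalRadius d < ENNReal.ofReal (Real.sqrt (2 * x)) := by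
    by_contra hcon
    have h1 := pow_le_pow_left' (not_lt.1 hcon) 2
    rw [← ENNReal.ofReal_pow (Real.sqrt_nonneg _), Real.sq_sqrt (by positivity)] at h1
    have h2 := (ENNReal.ofReal_le_ofReal_iff hx.le).1 (h1.trans h)
    linarith
  simp only [PolyTimeTest.criticalRadius, iInf_lt_iff] at hlt
  obtain ⟨ε, _, hrisk, hε⟩ := hlt
  exact ⟨ε, (ENNReal.ofReal_lt_ofReal_iff'.1 hε).1.le, hrisk⟩

/-- With `D = n / 2`, `n ≤ 3 * D ≤ D ^ 2` gives `log n ≤ 2 * log D ≤ (log D) ^ 2`. -/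
theorem log_log_le_of_half {n : ℕ} (h3 : 3 ≤ n / 2) (hlog : 2 ≤ Real.log ((n / 2 : ℕ) : ℝ)) :
    Real.log (Real.log n) ≤ 2 * Real.log (Real.log ((n / 2 : ℕ) : ℝ)) := by
  have hd : (3 : ℝ) ≤ ((n / 2 : ℕ) : ℝ) := by exact_mod_cast h3
  have hn3 : (n : ℝ) ≤ 3 * ((n / 2 : ℕ) : ℝ) := by exact_mod_cast (by omega : n ≤ 3 * (n / 2))
  have hn2 : (1 : ℝ) < n := by exact_mod_cast (by omega : 1 < n)
  have h1 : Real.log n ≤ Real.log ((n / 2 : ℕ) : ℝ) ^ 2 := by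
    calc Real.log n ≤ Real.log (((n / 2 : ℕ) : ℝ) ^ 2) :=
          Real.log_le_log (by linarith) (by nlinarith)
      _ = 2 * Real.log ((n / 2 : ℕ) : ℝ) := by rw [Real.log_pow]; norm_num
      _ ≤ _ := by nlinarith
  calc Real.log (Real.log n) ≤ Real.log (Real.log ((n / 2 : ℕ) : ℝ) ^ 2) :=
        Real.log_le_log (Real.log_pos hn2) h1
    _ = _ := by rw [Real.log_pow]; norm_num

theorem sqrt_radius_le {n : ℕ} (h3 : 3 ≤ n / 2) (hlog : 2 ≤ Real.log ((n / 2 : ℕ) : ℝ))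
    (hll : 0 < Real.log (Real.log n)) {k : ℝ}
    (hk : Real.sqrt n / Real.log (Real.log n) / 2 ≤ k) :
    Real.sqrt (2 * (1 / 16384 / ((n / 2 : ℕ) * Real.log (Real.log ((n / 2 : ℕ) : ℝ)) ^ 2))) ≤
      1 / ((n / 2 : ℕ) : ℝ) * (k / 32) := by
  have hle := log_log_le_of_half h3 hlog
  have hn2 : 2 * ((n / 2 : ℕ) : ℝ) ≤ n := by exact_mod_cast (by omega : 2 * (n / 2) ≤ n)
  have hd0 : (0 : ℝ) < ((n / 2 : ℕ) : ℝ) := by exact_mod_cast (by omega : 0 < n / 2)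
  set D : ℝ := ((n / 2 : ℕ) : ℝ)
  set l := Real.log (Real.log D)
  have hl : 0 < l := by linarith
  have hk2 : Real.sqrt n / (4 * l) ≤ k := by
    refine le_trans ?_ hk
    rw [div_div]
    exact div_le_div_of_nonneg_left (Real.sqrt_nonneg _) (by positivity) (by linarith)
  have hk0 : 0 ≤ k := le_trans (by positivity) hk2
  refine Real.sqrt_le_iff.2 ⟨by positivity, ?_⟩
  have hk3 : (n : ℝ) / (16 * l ^ 2) ≤ k ^ 2 := by
    have := pow_le_pow_left₀ (by positivity) hk2 2
    rw [div_pow, Real.sq_sqrt (by positivity)] at this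
    calc (n : ℝ) / (16 * l ^ 2) = n / (4 * l) ^ 2 := by ring
      _ ≤ _ := this
  have hk4 : 2 * D / (16 * l ^ 2) ≤ k ^ 2 :=
    (div_le_div_of_nonneg_right hn2 (by positivity)).trans hk3
  -- `16384 = 1024 * 16`: `1024 = 32 ^ 2` from the distance bound, `16` from `k ≥ √n / (4 * l)`.
  calc 2 * (1 / 16384 / (D * l ^ 2)) = (1 / D) ^ 2 / 1024 * (2 * D / (16 * l ^ 2)) := by
        field_simp; norm_num
    _ ≤ (1 / D) ^ 2 / 1024 * k ^ 2 := by gcongr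
    _ = _ := by ring

theorem PolyTimeTest.eventually_errorProb_le (φ : PolyTimeTest) :
    ∀ᶠ n : ℕ in atTop,
      φ.criticalRadius (n / 2) ^ 2 ≤ ENNReal.ofReal
        (1 / 16384 / ((n / 2 : ℕ) * Real.log (Real.log ((n / 2 : ℕ) : ℝ)) ^ 2)) →
      φ.toGraphAlgorithm.errorProb n (cliqueSize n) ≤ 1 / 2 - 1 / 12 := by
  have hlog : Tendsto (fun n : ℕ => Real.log ((n / 2 : ℕ) : ℝ)) atTop atTop :=
    Real.tendsto_log_atTop.comp (tendsto_natCast_atTop_atTop.comp tendsto_half)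
  have hll : Tendsto (fun n : ℕ => Real.log (Real.log ((n / 2 : ℕ) : ℝ))) atTop atTop :=
    Real.tendsto_log_atTop.comp hlog
  filter_upwards [eventually_ge_atTop 8, hlog.eventually_ge_atTop 2, hll.eventually_gt_atTop 0,
    tendsto_log_log_nat.eventually_ge_atTop 5, eventually_le_cliqueSize, eventually_cliqueSize_le,
    tendsto_cliqueSize.eventually_ge_atTop 2000] with n hn hlog hll hlln hk hk' hkbig hφ
  have h3 : 3 ≤ n / 2 := by omega
  have hd0 : (0 : ℝ) < ((n / 2 : ℕ) : ℝ) := by exact_mod_cast (by omega : 0 < n / 2)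
  obtain ⟨ε, hε, hrisk⟩ := φ.exists_radius (by positivity) hφ
  have hε' := hε.trans (sqrt_radius_le h3 hlog (by linarith) hk)
  have hkpos : 0 < cliqueSize n := by
    have : (0 : ℝ) < cliqueSize n := by linarith
    exact_mod_cast this
  have hn0 : (0 : ℝ) < n := by exact_mod_cast (by omega : 0 < n)
  refine max_le ((φ.errorNull_le hrisk).trans (by norm_num)) ?_
  refine (φ.errorPlanted_le hn hkpos (cliqueSize_le n) hε' hrisk).trans ?_
  -- `1/3 + 1/25 + 64/2000 < 5/12 = 1/2 - 1/12`.
  have h64 : (64 : ℝ) / cliqueSize n ≤ 64 / 2000 := by gcongr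
  have hsq : (cliqueSize n : ℝ) ^ 2 / n ≤ 1 / 25 := by
    have h5 : (cliqueSize n : ℝ) ≤ Real.sqrt n / 5 :=
      hk'.trans (div_le_div_of_nonneg_left (Real.sqrt_nonneg _) (by norm_num) hlln)
    rw [div_le_iff₀ hn0]
    have := pow_le_pow_left₀ (by positivity) h5 2
    rw [div_pow, Real.sq_sqrt hn0.le] at this
    linarith
  norm_num at h64 ⊢
  linarith

theorem theorem4 :
    (PlantedCliqueConjecture →
      ∃ c : ℝ, 0 < c ∧ ∀ φ : PolyTimeTest, ∀ᶠ d : ℕ in atTop,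
        ENNReal.ofReal (c / (d * (Real.log (Real.log d)) ^ 2)) < φ.criticalRadius d ^ 2) ∧
    (WeakPlantedCliqueConjecture →
      ∃ c : ℝ, 0 < c ∧ ∀ φ : PolyTimeTest, ∃ᶠ d : ℕ in atTop,
        ENNReal.ofReal (c / (d * (Real.log (Real.log d)) ^ 2)) < φ.criticalRadius d ^ 2) := by
  constructor
  · intro h
    refine ⟨1 / 16384, by norm_num, fun φ => ?_⟩
    have hA := h cliqueSize cliqueSize_le cliqueSize_isLittleO φ.toGraphAlgorithm (1 / 12)
      (by norm_num)
    -- Every large `d` is reached from the graph size `n = 2 * d`. In the weak case below,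
    -- infinitely many `n` give infinitely many `n / 2`.
    have hdouble : Tendsto (fun d : ℕ => 2 * d) atTop atTop :=
      tendsto_id.const_mul_atTop' (by norm_num)
    filter_upwards [hdouble.eventually (hA.and φ.eventually_errorProb_le)] with d hd
    by_contra hcon
    rw [Nat.mul_div_cancel_left d (by norm_num)] at hd
    exact absurd (hd.2 (not_lt.1 hcon)) (not_le.2 hd.1)
  · intro h
    refine ⟨1 / 16384, by norm_num, fun φ => ?_⟩
    have hA := h cliqueSize cliqueSize_le cliqueSize_isLittleO φ.toGraphAlgorithm (1 / 12)
      (by norm_num)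
    refine tendsto_half.frequently ((hA.and_eventually φ.eventually_errorProb_le).mono ?_)
    intro n hn
    by_contra hcon
    exact absurd (hn.2 (not_lt.1 hcon)) (not_le.2 hn.1)
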